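/- For integers $m\ge 2$ and $n\ge 3$, the generalized closed web $CW_{m,n}$ is the graph obtained from the generalized prism $P_m\,\Box\,C_n$ (the Cartesian product of the path on $m$ vertices and the cycle on $n$ vertices) by adding one new vertex and joining it by an edge to every vertex of the top cycle (the copy of $C_n$ at one end of the path $P_m$). For a graph $G=(V,E)$ with $q$ edges and an Abelian group $\Gamma$ of order $q$, we say that $G$ is $\Gamma$-harmonious if there is an injection $f\colon V\to\Gamma$ such that $xy\mapsto f(x)+f(y)$ is a bijection from $E$ to $\Gamma$. A finite Abelian group $\Gamma$ is written in nested form as $\Gamma\cong\mathbb Z_{n_1}\oplus\mathbb Z_{n_2}\oplus\dots\oplus\mathbb Z_{n_t}$ if $n_t\ge 2$, $|\Gamma|=n_1n_2\cdots n_t$ and $n_{i+1}\mid n_i$ for $i=1,\dots,t-1$. **Corollary.** Let $n\ge 4$ be even, let $m\ge 2$, and let $\Gamma$ be an Abelian group of order $2mn$, written in nested form as $\Gamma\cong\mathbb Z_{n_1}\oplus\mathbb Z_{n_2}\oplus\dots\oplus\mathbb Z_{n_t}$ with $t\ge 2$, which has a cyclic subgroup of order $2m$. Suppose that at least one of the following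 conditions holds: 1. $n_1\equiv 0\pmod{8m}$ and $n_2\equiv 0\pmod 2$; 2. $n_1\equiv 0\pmod{4m}$, $n_2\equiv 0\pmod 2$ and $n_2\ge 4$; 3. $t\ge 3$, $n_1\equiv 0\pmod{2m}$, $n_2\equiv 0\pmod 4$ and $n_3\equiv 0\pmod 2$; 4. $t\ge 3$, $n_1\equiv 0\pmod{2m}$, $n_3\equiv 0\pmod 2$, and $n_t>1$ is odd. Then the closed web $CW_{m,n}$ is $\Gamma$-harmonious. -/

import Mathlib

/-- The generalized closed web `CW_{m,n}`: the generalized prism `P_m □ C_n`, with vertices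
`some (j, i)` (`j` the index of the copy of the cycle, `i` the position on that copy), together
with a new central vertex `none`, joined by an edge to every vertex of the top cycle `j = 0`. -/
def closedWeb (m n : ℕ) : SimpleGraph (Option (Fin m × Fin n)) where
  Adj
    | none, none => False
    | none, some q => (q.1 : ℕ) = 0
    | some p, none => (p.1 : ℕ) = 0
    | some p, some q =>
        (SimpleGraph.boxProd (SimpleGraph.pathGraph m) (SimpleGraph.cycleGraph n)).Adj p q
  symm := ⟨by
    rintro (_ | p) (_ | q) h
    · exact h
    · exact h
    · exact h
    · exact SimpleGraph.Adj.symm h⟩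
  loopless := ⟨by
    rintro (_ | p) h
    · exact h
    · exact SimpleGraph.irrefl _ h⟩

/-- The label `w(xy) = f(x) + f(y)` which a vertex labeling `f` induces on the edge `xy`. -/
def inducedLabel {V Γ : Type*} [AddCommGroup Γ] (f : V → Γ) : Sym2 V → Γ :=
  Sym2.lift ⟨fun x y => f x + f y, fun x y => add_comm (f x) (f y)⟩

/-- `G` is `Γ`-harmonious: some injective vertex labeling `f : V → Γ` induces a bijection from the
edge set of `G` onto `Γ` (so that the number of edges of `G` is the order of `Γ`). -/
def IsHarmonious {V : Type*} (G : SimpleGraph V) (Γ : Type*) [AddCommGroup Γ] : Prop :=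
  ∃ f : V → Γ, Function.Injective f ∧
    Function.Bijective (fun e : G.edgeSet => inducedLabel f (e : Sym2 V))

/-- `Γ ≅ Z_{ν 0} ⊕ Z_{ν 1} ⊕ ⋯ ⊕ Z_{ν (t - 1)}` is a nested form of `Γ`: every `ν i` is at least
`2`, and each `ν (i + 1)` divides `ν i`. -/
def IsNestedForm (Γ : Type*) [AddCommGroup Γ] {t : ℕ} (ν : Fin t → ℕ) : Prop :=
  (∀ i, 2 ≤ ν i) ∧
  (∀ i j : Fin t, (j : ℕ) = (i : ℕ) + 1 → ν j ∣ ν i) ∧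
  Nonempty (Γ ≃+ ((i : Fin t) → ZMod (ν i)))

/-! Let `H = ⟨h⟩` be cyclic of order `2m`. Suppose a cyclic sequence `a_0, …, a_{n-1}` represents
every coset of `H` once, and its consecutive sums `b_s = a_s + a_{s+1}` are again the terms `a_i`.
Label vertex `(j, i)` by `a_{i+j} + j h` and the centre by `-h`. Level `j` then has cycle edges
labelled `b_s + 2j h`, the path edges below it get `b_s + (2j+1) h`, and the edges at the centre get
`a_i - h`, that is, `b_s + (2m-1) h` up to order. So every `b_s + k h` with `k < 2m` occurs exactly
once, and these are all the group elements (`closedWeb_isHarmonious_of_harmMod`).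

It remains to find such a sequence. `HarmMod H N n` asks for it with the sums taken only modulo `N`.
If a sequence is known modulo `N` and `N` is cyclic of odd order, cyclic of order 4, or a
four-group, then suitable translates of its terms by elements of `N` can be woven into one longer
cycle that is exact (`weave_odd`, `weave_four`, `weave_four_group`; the last two need even length).
Any finite abelian group of order other than 1 and 2 contains a subgroup of order 4 or of odd prime
order, so weaving descends from `N` of index at most 2 in a chosen subgroup `K` down to `N = 0`
(`HarmMod.of_relIndex`).

For the base cases write `G/H = ⟨g⟩ ⊕ D` with `g` of order `2k` modulo `H`, and choose a character
of `D` onto `ℤ/s` with kernel `K`, where `s = 2` if `k ≥ 2` and `s = 4` if `k = 1`. Then `D/N` is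
`ℤ/s`, `ℤ/2s` or `ℤ/s ⊕ ℤ/2`. The base sequences live in `ℤ × A`, where `A` is this group and `(1,
0)` goes to `g`. Their sums are exact integers, so the actual value of `2k g` in `H` does not
matter. The divisibility conditions serve to find `g`, `D` and the character. -/

/-! ### Walks and harmonious cyclic sequences -/

/-- There is a walk (a list of length `n`) from `u` to `v` that visits all elements of `V`, and such
that every element of `S` is the sum of two consecutive entries. -/
def WPath {G : Type*} [Add G] (u v : G) (V S : Set G) (n : ℕ) : Prop :=
  ∃ l : List G, l.length = n ∧ (∃ l₁, l = u :: l₁) ∧ (∃ l₂, l = l₂ ++ [v]) ∧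
    (∀ y ∈ V, y ∈ l) ∧ ∀ s ∈ S, ∃ x y, [x, y] <:+: l ∧ x + y = s

namespace WPath

theorem single {G : Type*} [Add G] (u : G) : WPath u u {u} ∅ 1 :=
  ⟨[u], rfl, ⟨[], rfl⟩, ⟨[], rfl⟩, by simp, by simp⟩

theorem append {G : Type*} [Add G] {u v u' w : G} {V S V' S' : Set G} {n n' : ℕ}
    (h : WPath u v V S n) (h' : WPath u' w V' S' n') :
    WPath u w (V ∪ V') (insert (v + u') (S ∪ S')) (n + n') := by
  obtain ⟨l, hl, ⟨l₁, h₁⟩, ⟨l₂, h₂⟩, hV, hS⟩ := h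
  obtain ⟨l', hl', ⟨l₁', h₁'⟩, ⟨l₂', h₂'⟩, hV', hS'⟩ := h'
  refine ⟨l ++ l', by simp [hl, hl'], ⟨l₁ ++ l', by simp [h₁]⟩, ⟨l ++ l₂', by simp [h₂']⟩, ?_, ?_⟩
  · rintro y (hy | hy)
    · exact List.mem_append_left _ (hV y hy)
    · exact List.mem_append_right _ (hV' y hy)
  · rintro s (rfl | hs | hs)
    · exact ⟨v, u', ⟨l₂, l₁', by simp [h₂, h₁']⟩, rfl⟩
    · obtain ⟨x, y, hxy, e⟩ := hS s hs
      exact ⟨x, y, hxy.trans (List.prefix_append l l').isInfix, e⟩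
    · obtain ⟨x, y, hxy, e⟩ := hS' s hs
      exact ⟨x, y, hxy.trans (List.suffix_append l l').isInfix, e⟩

theorem reverse {G : Type*} [AddCommMagma G] {u v : G} {V S : Set G} {n : ℕ}
    (h : WPath u v V S n) : WPath v u V S n := by
  obtain ⟨l, hl, ⟨l₁, h₁⟩, ⟨l₂, h₂⟩, hV, hS⟩ := h
  refine ⟨l.reverse, by simp [hl], ⟨l₂.reverse, by simp [h₂]⟩, ⟨l₁.reverse, by simp [h₁]⟩,
    fun y hy => List.mem_reverse.2 (hV y hy), fun s hs => ?_⟩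
  obtain ⟨x, y, hxy, e⟩ := hS s hs
  refine ⟨y, x, ?_, by rw [add_comm, e]⟩
  have := List.reverse_infix.2 hxy
  simpa using this

theorem mono {G : Type*} [Add G] {u v : G} {V S V' S' : Set G} {n : ℕ}
    (h : WPath u v V S n) (hV : V' ⊆ V) (hS : S' ⊆ S) : WPath u v V' S' n := by
  obtain ⟨l, hl, h₁, h₂, hV', hS'⟩ := h
  exact ⟨l, hl, h₁, h₂, fun y hy => hV' y (hV hy), fun s hs => hS' s (hS hs)⟩

theorem cons {G : Type*} [Add G] {v u' : G} {V S : Set G} {n : ℕ}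
    (u : G) (h : WPath u' v V S n) : WPath u v (insert u V) (insert (u + u') S) (n + 1) := by
  have := (single u).append h
  rw [add_comm 1 n] at this
  exact this.mono (by intro x hx; simpa using hx) (by intro x hx; simpa using hx)

theorem snoc {G : Type*} [Add G] {v u : G} {V S : Set G} {n : ℕ}
    (h : WPath u v V S n) (w : G) : WPath u w (insert w V) (insert (v + w) S) (n + 1) :=
  (h.append (single w)).mono (by intro x hx; simpa [or_comm] using hx)
    (by intro x hx; simpa using hx)

end WPath

/-- A cyclic sequence of length `n` that meets every coset of `H ⊔ N`, and all of whose terms are,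
modulo `N`, sums of two cyclically consecutive terms. -/
def HarmMod {G : Type*} [AddCommGroup G] (H N : AddSubgroup G) (n : ℕ) : Prop :=
  ∃ a : ℕ → G, (∀ q, ∃ i < n, a i - q ∈ H ⊔ N) ∧
    ∀ i < n, (∃ j, j + 1 < n ∧ a j + a (j + 1) - a i ∈ N) ∨ a (n - 1) + a 0 - a i ∈ N

/-- A list of `n` entries meeting all `n` cosets meets each exactly once. Hence no entry lies
outside `V`, and it suffices that the elements of `V` are sums modulo `N`. -/
theorem WPath.harmMod {G : Type*} [AddCommGroup G] {H N : AddSubgroup G} {n : ℕ} {u v : G}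
    {V S : Set G} (h : WPath u v V S n) (hn : (H ⊔ N).index = n)
    (hV : ∀ q, ∃ y ∈ V, y - q ∈ H ⊔ N) (hS : ∀ y ∈ V, ∃ s ∈ insert (v + u) S, s - y ∈ N) :
    HarmMod H N n := by
  obtain ⟨l, hl, ⟨l₁, h₁⟩, ⟨l₂, h₂⟩, hV', hS'⟩ := h
  have hpos : 0 < n := by rw [← hl, h₁]; simp
  have hcov : ∀ q, ∃ i < n, l.getD i 0 ∈ V ∧ l.getD i 0 - q ∈ H ⊔ N := fun q => by
    obtain ⟨y, hy, hq⟩ := hV q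
    obtain ⟨i, hi, rfl⟩ := List.getElem_of_mem (hV' y hy)
    rw [← List.getD_eq_getElem _ 0 hi] at hy hq
    exact ⟨i, hl ▸ hi, hy, hq⟩
  have hinj : Function.Injective
      (fun i : Fin n => (QuotientAddGroup.mk (l.getD i 0) : G ⧸ (H ⊔ N))) := by
    have hc : Nat.card (G ⧸ (H ⊔ N)) = n := hn
    have : Finite (G ⧸ (H ⊔ N)) := Nat.finite_of_card_ne_zero (by omega)
    have hsurj : Function.Surjective
        (fun i : Fin n => (QuotientAddGroup.mk (l.getD i 0) : G ⧸ (H ⊔ N))) := by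
      intro q
      obtain ⟨q, rfl⟩ := QuotientAddGroup.mk_surjective q
      obtain ⟨i, hi, -, hq⟩ := hcov q
      refine ⟨⟨i, hi⟩, ?_⟩
      rw [eq_comm, QuotientAddGroup.eq]
      rwa [sub_eq_neg_add] at hq
    exact ((Nat.bijective_iff_surjective_and_card _).2 ⟨hsurj, by simp [hc]⟩).1
  refine ⟨fun i => l.getD i 0, fun q => ?_, fun i hi => ?_⟩
  · obtain ⟨i, hi, -, hq⟩ := hcov q
    exact ⟨i, hi, hq⟩
  · have hy : l.getD i 0 ∈ V := by
      obtain ⟨j, hj, hjV, hjq⟩ := hcov (l.getD i 0)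
      have : (⟨i, hi⟩ : Fin n) = ⟨j, hj⟩ := hinj (by
        change (QuotientAddGroup.mk (l.getD i 0) : G ⧸ (H ⊔ N)) = QuotientAddGroup.mk (l.getD j 0)
        rw [QuotientAddGroup.eq, ← sub_eq_neg_add]
        exact hjq)
      have hij : i = j := by simpa using this
      rw [hij]; exact hjV
    obtain ⟨s, hs, hsN⟩ := hS _ hy
    rcases hs with rfl | hs
    · right
      have e0 : l.getD 0 0 = u := by simp [h₁]
      have e1 : l.getD (n - 1) 0 = v := by
        rw [← hl, h₂]; simp
      simp only [e0, e1]
      exact hsN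
    · left
      obtain ⟨x, y, ⟨s₁, s₂, e⟩, rfl⟩ := hS' s hs
      refine ⟨s₁.length, ?_, ?_⟩
      · rw [← hl, ← e]; simp
      · have e0 : l.getD s₁.length 0 = x := by rw [← e]; simp
        have e1 : l.getD (s₁.length + 1) 0 = y := by rw [← e]; simp
        simp only [e0, e1]
        exact hsN

theorem HarmMod.mono {G : Type*} [AddCommGroup G] {H N N' : AddSubgroup G} {n : ℕ}
    (h : HarmMod H N n) (hN : N ≤ N') : HarmMod H N' n := by
  obtain ⟨a, h₁, h₂⟩ := h
  refine ⟨a, fun q => ?_, fun i hi => ?_⟩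
  · obtain ⟨i, hi, hq⟩ := h₁ q
    exact ⟨i, hi, sup_le_sup_left hN H hq⟩
  · rcases h₂ i hi with ⟨j, hj, h⟩ | h
    · exact Or.inl ⟨j, hj, hN h⟩
    · exact Or.inr (hN h)

theorem HarmMod.map {G G' : Type*} [AddCommGroup G] [AddCommGroup G'] {H N : AddSubgroup G}
    {H' N' : AddSubgroup G'} {n : ℕ} (φ : G →+ G') (h : HarmMod H N n)
    (hH : ∀ x ∈ H, φ x ∈ H') (hN : ∀ x ∈ N, φ x ∈ N') (hφ : ∀ q, ∃ x, φ x - q ∈ H' ⊔ N') :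
    HarmMod H' N' n := by
  obtain ⟨a, h₁, h₂⟩ := h
  have hsup : H ⊔ N ≤ (H' ⊔ N').comap φ :=
    sup_le (fun x hx => (le_sup_left : H' ≤ H' ⊔ N') (hH x hx))
      (fun x hx => (le_sup_right : N' ≤ H' ⊔ N') (hN x hx))
  refine ⟨fun i => φ (a i), fun q => ?_, fun i hi => ?_⟩
  · obtain ⟨x, hx⟩ := hφ q
    obtain ⟨i, hi, hq⟩ := h₁ x
    refine ⟨i, hi, ?_⟩
    have := add_mem (show φ (a i - x) ∈ H' ⊔ N' from hsup hq) hx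
    simpa using this
  · rcases h₂ i hi with ⟨j, hj, h⟩ | h
    · exact Or.inl ⟨j, hj, by simpa using hN _ h⟩
    · exact Or.inr (by simpa using hN _ h)

/-- Both conditions are insensitive to changes by elements of `N`, so arbitrary lifts from `G ⧸ L`
will do. -/
theorem HarmMod.of_quotient {G : Type*} [AddCommGroup G] {H N L : AddSubgroup G} {n : ℕ}
    (h : HarmMod (H.map (QuotientAddGroup.mk' L)) (N.map (QuotientAddGroup.mk' L)) n)
    (hL : L ≤ N) : HarmMod H N n := by
  obtain ⟨a, h₁, h₂⟩ := h
  have hout : ∀ x : G ⧸ L, QuotientAddGroup.mk' L (Quotient.out x) = x := fun x =>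
    Quotient.out_eq' x
  have hc : ∀ K : AddSubgroup G, L ≤ K → ∀ x, QuotientAddGroup.mk' L x ∈
      K.map (QuotientAddGroup.mk' L) → x ∈ K := by
    rintro K hK x ⟨y, hy, e⟩
    rw [QuotientAddGroup.mk'_eq_mk'] at e
    obtain ⟨z, hz, rfl⟩ := e
    exact add_mem hy (hK hz)
  rw [← AddSubgroup.map_sup] at h₁
  refine ⟨fun i => Quotient.out (a i), fun q => ?_, fun i hi => ?_⟩
  · obtain ⟨i, hi, hq⟩ := h₁ (QuotientAddGroup.mk' L q)
    refine ⟨i, hi, hc _ (hL.trans le_sup_right) _ ?_⟩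
    rwa [map_sub, hout]
  · rcases h₂ i hi with ⟨j, hj, h⟩ | h
    · exact Or.inl ⟨j, hj, hc _ hL _ (by rwa [map_sub, map_add, hout, hout, hout])⟩
    · exact Or.inr (hc _ hL _ (by rwa [map_sub, map_add, hout, hout, hout]))

theorem HarmMod.to_quotient {G : Type*} [AddCommGroup G] {H N : AddSubgroup G} {n : ℕ}
    (h : HarmMod H N n) (L : AddSubgroup G) :
    HarmMod (H.map (QuotientAddGroup.mk' L)) (N.map (QuotientAddGroup.mk' L)) n :=
  h.map (QuotientAddGroup.mk' L) (fun x hx => ⟨x, hx, rfl⟩) (fun x hx => ⟨x, hx, rfl⟩) fun q => by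
    obtain ⟨x, rfl⟩ := QuotientAddGroup.mk'_surjective L q
    exact ⟨x, by simp⟩

/-! ### From a harmonious sequence to a labeling of the closed web -/

theorem exists_nsmul_of_mem_zmultiples {G : Type*} [AddCommGroup G] {h x : G} {r : ℕ} (hr : 0 < r)
    (hh : addOrderOf h = r) (hx : x ∈ AddSubgroup.zmultiples h) : ∃ e < r, x = e • h := by
  obtain ⟨z, rfl⟩ := hx
  refine ⟨(z % r).toNat, ?_, ?_⟩
  · have := Int.emod_lt_of_pos z (by exact_mod_cast hr : (0 : ℤ) < r)
    have := Int.emod_nonneg z (by exact_mod_cast hr.ne' : (r : ℤ) ≠ 0)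
    omega
  · rw [← natCast_zsmul, Int.toNat_of_nonneg (Int.emod_nonneg z (by exact_mod_cast hr.ne')), ← hh,
      mod_addOrderOf_zsmul]

theorem closedWeb_isHarmonious_of_harmMod {G : Type*} [AddCommGroup G] {m n : ℕ} (hm : 1 ≤ m)
    (hn : 3 ≤ n) (hG : Nat.card G = 2 * m * n) (h : G) (hh : addOrderOf h = 2 * m)
    (hH : HarmMod (AddSubgroup.zmultiples h) ⊥ n) : IsHarmonious (closedWeb m n) G := by
  classical
  obtain ⟨a₀, ha₀, hs₀⟩ := hH
  set H := AddSubgroup.zmultiples h with hHdef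
  have : NeZero n := ⟨by omega⟩
  have hpos : 0 < 2 * m * n := by positivity
  have hfin : Finite G := Nat.finite_of_card_ne_zero (by omega)
  have hcardH : Nat.card H = 2 * m := by rw [hHdef, Nat.card_zmultiples, hh]
  have hidx : Nat.card (G ⧸ H) = n := by
    have := AddSubgroup.card_eq_card_quotient_mul_card_addSubgroup H
    rw [hG, hcardH, mul_comm] at this
    exact (Nat.eq_of_mul_eq_mul_right (by omega) this).symm
  -- the sequence, indexed by `Fin n`
  obtain ⟨a, hcov, hsum⟩ : ∃ a : Fin n → G, (∀ q, ∃ i, a i - q ∈ H) ∧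
      ∀ i, ∃ j, a j + a (j + 1) = a i := by
    refine ⟨fun i => a₀ i, fun q => ?_, fun i => ?_⟩
    · obtain ⟨i, hi, hq⟩ := ha₀ q
      exact ⟨⟨i, hi⟩, by simpa using hq⟩
    · rcases hs₀ i i.2 with ⟨j, hj, e⟩ | e
      · refine ⟨⟨j, by omega⟩, ?_⟩
        have : ((⟨j, by omega⟩ : Fin n) + 1 : Fin n).val = j + 1 := by
          rw [Fin.val_add, Fin.val_one', Nat.mod_eq_of_lt (a := 1) (by omega),
            Nat.mod_eq_of_lt (by simpa using hj)]
        simp only [this]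
        rw [AddSubgroup.mem_bot] at e
        exact sub_eq_zero.1 e
      · refine ⟨⟨n - 1, by omega⟩, ?_⟩
        have : ((⟨n - 1, by omega⟩ : Fin n) + 1 : Fin n).val = 0 := by
          rw [Fin.val_add, Fin.val_one', Nat.mod_eq_of_lt (a := 1) (by omega)]
          simp [Nat.sub_add_cancel (by omega : 1 ≤ n)]
        simp only [this]
        rw [AddSubgroup.mem_bot] at e
        exact sub_eq_zero.1 e
  have hinj : ∀ i j, a i - a j ∈ H → i = j := by
    have hsurj : Function.Surjective (fun i : Fin n => (QuotientAddGroup.mk (a i) : G ⧸ H)) := by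
      intro q
      obtain ⟨q, rfl⟩ := QuotientAddGroup.mk_surjective q
      obtain ⟨i, hq⟩ := hcov q
      refine ⟨i, ?_⟩
      rw [eq_comm, QuotientAddGroup.eq]
      rwa [sub_eq_neg_add] at hq
    have := ((Nat.bijective_iff_surjective_and_card _).2 ⟨hsurj, by simp [hidx]⟩).1
    intro i j hij
    apply this
    change (QuotientAddGroup.mk (a i) : G ⧸ H) = QuotientAddGroup.mk (a j)
    rw [eq_comm, QuotientAddGroup.eq]
    rwa [sub_eq_neg_add] at hij
  choose τ hτ using hsum
  have hτinj : Function.Injective τ := fun i j e => hinj i j (by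
    rw [← hτ i, ← hτ j, e, sub_self]; exact H.zero_mem)
  have hτbij : Function.Bijective τ := Finite.injective_iff_bijective.1 hτinj
  -- the element of the sequence in `H` is zero
  have hzero : ∀ i, a i ∈ H → a i = 0 := by
    intro i hi
    obtain ⟨s, hs⟩ := hτbij.2 i
    have e := hτ s
    rw [hs] at e
    -- The term `a i` is added to `a (i + 1)` to give `a s`. If `a i ∈ H`, then `a (i + 1)` and `a
    -- s` share a coset, so they are the same term and `a i = 0`.
    have : i + 1 = s := hinj _ _ (by
      rw [← e]
      have : a (i + 1) - (a i + a (i + 1)) = - a i := by abel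
      rw [this]; exact neg_mem hi)
    rw [this] at e
    simpa using e
  have hhH : ∀ e : ℕ, e • h ∈ H := fun e => nsmul_mem (AddSubgroup.mem_zmultiples h) e
  have hmul : ∀ e e' : ℕ, e < 2 * m → e' < 2 * m → e • h = e' • h → e = e' := by
    intro e e' he he' heq
    rw [← hh] at he he'
    exact nsmul_injOn_Iio_addOrderOf he he' heq
  have h2m : (2 * m) • h = 0 := by rw [← hh, addOrderOf_nsmul_eq_zero]
  -- The sequence is rotated by one place per level, so that a path edge, like a cycle edge, joins
  -- consecutive terms.
  let t : Fin m × Fin n → Fin n := fun p => Fin.ofNat n (p.1 + p.2)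
  let f : Option (Fin m × Fin n) → G
    | none => -h
    | some p => a (t p) + (p.1 : ℕ) • h
  have ht_inj : ∀ p q : Fin m × Fin n, p.1 = q.1 → t p = t q → p = q := by
    rintro ⟨j, i⟩ ⟨j', i'⟩ e e'
    obtain rfl : j = j' := e
    have : ((j : ℕ) + i) % n = (j + i') % n := congrArg Fin.val e'
    have h1 : (i : ℕ) % n = i' % n := Nat.ModEq.add_left_cancel' (j : ℕ) this
    rw [Nat.mod_eq_of_lt i.2, Nat.mod_eq_of_lt i'.2] at h1
    rw [Fin.ext h1]
  have ht_surj : ∀ (j : Fin m) (s : Fin n), ∃ i, t (j, i) = s := by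
    intro j s
    have : Function.Injective (fun i => t (j, i)) := fun i i' e =>
      (Prod.ext_iff.1 (ht_inj (j, i) (j, i') rfl e)).2
    exact (Finite.injective_iff_surjective.1 this) s
  have ht_succ : ∀ j i, t (j, i + 1) = t (j, i) + 1 := by
    intro j i
    apply Fin.ext
    simp only [t, Fin.ofNat, Fin.val_add, Fin.val_one', Nat.add_mod_mod, Nat.mod_add_mod, add_assoc]
  have ht_down : ∀ (j j' : Fin m) i, (j' : ℕ) = j + 1 → t (j', i) = t (j, i) + 1 := by
    intro j j' i e
    apply Fin.ext
    simp only [t, Fin.ofNat, Fin.val_add, Fin.val_one', e]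
    simp [add_right_comm]
  refine ⟨f, ?_, ?_⟩
  -- The only labels in `H` on the prism are `j h` with `j < m`, while `-h = (2m-1) h`.
  · have key : ∀ p, f (some p) ≠ -h := by
      intro p hp
      have hp' : a (t p) + (p.1 : ℕ) • h = -h := hp
      have hmem : a (t p) ∈ H := by
        rw [eq_sub_of_add_eq hp']
        exact sub_mem (neg_mem (AddSubgroup.mem_zmultiples h)) (hhH _)
      rw [hzero _ hmem, zero_add] at hp'
      have : ((p.1 : ℕ) + 1) • h = 0 • h := by rw [succ_nsmul, hp']; simp
      have := hmul _ _ (by have := p.1.2; omega) (by omega) this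
      omega
    rintro (_ | p) (_ | q) e
    · rfl
    · exact absurd e.symm (key q)
    · exact absurd e (key p)
    · have e' : a (t p) + (p.1 : ℕ) • h = a (t q) + (q.1 : ℕ) • h := e
      have ht : t p = t q := hinj _ _ (by
        have : a (t p) - a (t q) = (q.1 : ℕ) • h - (p.1 : ℕ) • h := by
          rw [sub_eq_sub_iff_add_eq_add, e', add_comm]
        rw [this]; exact sub_mem (hhH _) (hhH _))
      rw [ht] at e'
      have := hmul _ _ (by have := p.1.2; omega) (by have := q.1.2; omega) (add_left_cancel e')
      rw [ht_inj p q (Fin.ext this) ht]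
  · let b : Fin n → G := fun s => a s + a (s + 1)
    have hbinj : ∀ s s' e e', e < 2 * m → e' < 2 * m → b s + e • h = b s' + e' • h →
        s = s' ∧ e = e' := by
      intro s s' e e' he he' heq
      obtain ⟨i, rfl⟩ := hτbij.2 s
      obtain ⟨i', rfl⟩ := hτbij.2 s'
      have hi : i = i' := hinj _ _ (by
        have : a i - a i' = e' • h - e • h := by
          rw [sub_eq_sub_iff_add_eq_add, ← hτ i, ← hτ i', add_comm (e' • h)]; exact heq
        rw [this]; exact sub_mem (hhH _) (hhH _))
      subst hi
      exact ⟨rfl, hmul _ _ he he' (add_left_cancel heq)⟩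
    have hbsurj : ∀ g, ∃ s, ∃ e < 2 * m, g = b s + e • h := by
      intro g
      obtain ⟨i, hi⟩ := hcov g
      obtain ⟨e, he, heq⟩ := exists_nsmul_of_mem_zmultiples (by omega) hh (neg_mem hi)
      refine ⟨τ i, e, he, ?_⟩
      rw [← heq]
      simp only [b, hτ]
      abel
    -- `R s k e` says that `e` is the edge meant to carry `b s + k h`: even `k` is a cycle edge, odd
    -- `k < 2m - 1` a path edge, and `k = 2m - 1` an edge at the centre.
    let R : Fin n → ℕ → Sym2 (Option (Fin m × Fin n)) → Prop := fun s k e =>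
      (∃ (j : Fin m) (i : Fin n), k = 2 * j ∧ t (j, i) = s ∧
        e = s(some (j, i), some (j, i + 1))) ∨
      (∃ (j j' : Fin m) (i : Fin n), (j' : ℕ) = j + 1 ∧ k = 2 * j + 1 ∧ t (j, i) = s ∧
        e = s(some (j, i), some (j', i))) ∨
      (∃ (j : Fin m) (i : Fin n), (j : ℕ) = 0 ∧ k = 2 * m - 1 ∧ a (t (j, i)) = b s ∧
        e = s(none, some (j, i)))
    have hRlabel : ∀ s k e, R s k e → inducedLabel f e = b s + k • h := by
      rintro s k e (⟨j, i, rfl, rfl, rfl⟩ | ⟨j, j', i, hj, rfl, rfl, rfl⟩ | ⟨j, i, hj, rfl, ha, rfl⟩)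
      · change a (t (j, i)) + (j : ℕ) • h + (a (t (j, i + 1)) + (j : ℕ) • h) = _
        rw [ht_succ, two_mul, add_nsmul]
        simp only [b]
        abel
      · change a (t (j, i)) + (j : ℕ) • h + (a (t (j', i)) + (j' : ℕ) • h) = _
        rw [ht_down j j' i hj, hj, two_mul, add_nsmul, add_nsmul, add_nsmul]
        simp only [b]
        abel
      · change -h + (a (t (j, i)) + (j : ℕ) • h) = _
        have : (2 * m - 1) • h = -h := by
          rw [eq_neg_iff_add_eq_zero, ← succ_nsmul, Nat.sub_add_cancel (by omega), h2m]
        rw [this, ← ha, hj]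
        simp [add_comm]
    have hRex : ∀ s k, k < 2 * m → ∃ e ∈ (closedWeb m n).edgeSet, R s k e := by
      intro s k hk
      rcases Nat.even_or_odd' k with ⟨j, rfl | rfl⟩
      · obtain ⟨i, hi⟩ := ht_surj ⟨j, by omega⟩ s
        refine ⟨_, ?_, Or.inl ⟨⟨j, by omega⟩, i, rfl, hi, rfl⟩⟩
        rw [SimpleGraph.mem_edgeSet]
        change (SimpleGraph.boxProd _ _).Adj _ _
        rw [SimpleGraph.boxProd_adj]
        right
        refine ⟨?_, rfl⟩
        rw [SimpleGraph.cycleGraph_adj']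
        right
        simp [Nat.mod_eq_of_lt (by omega : 1 < n)]
      · by_cases hj : j + 1 < m
        · obtain ⟨i, hi⟩ := ht_surj ⟨j, by omega⟩ s
          refine ⟨_, ?_, Or.inr (Or.inl ⟨⟨j, by omega⟩, ⟨j + 1, hj⟩, i, rfl, rfl, hi, rfl⟩)⟩
          rw [SimpleGraph.mem_edgeSet]
          change (SimpleGraph.boxProd _ _).Adj _ _
          rw [SimpleGraph.boxProd_adj]
          left
          refine ⟨?_, rfl⟩
          rw [SimpleGraph.pathGraph_adj]
          left
          rfl
        · obtain ⟨i', rfl⟩ := hτbij.2 s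
          obtain ⟨i, hi⟩ := ht_surj ⟨0, by omega⟩ i'
          refine ⟨_, ?_, Or.inr (Or.inr ⟨⟨0, by omega⟩, i, rfl, by omega, ?_, rfl⟩)⟩
          · rw [SimpleGraph.mem_edgeSet]
            change (0 : ℕ) = 0
            rfl
          · rw [hi]
            exact (hτ i').symm
    have hRtot : ∀ e ∈ (closedWeb m n).edgeSet, ∃ s, ∃ k < 2 * m, R s k e := by
      have hnone : ∀ (j : Fin m) (i : Fin n), (j : ℕ) = 0 → ∃ s, ∃ k < 2 * m, R s k s(none, some (j, i)) :=
        fun j i hj => ⟨τ (t (j, i)), 2 * m - 1, by omega,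
          Or.inr (Or.inr ⟨j, i, hj, rfl, (hτ _).symm, rfl⟩)⟩
      intro e
      induction e using Sym2.ind with
      | _ x y =>
        rw [SimpleGraph.mem_edgeSet]
        rcases x with _ | ⟨j, i⟩ <;> rcases y with _ | ⟨j', i'⟩ <;> intro hadj
        · exact hadj.elim
        · exact hnone _ _ hadj
        · rw [Sym2.eq_swap]
          exact hnone _ _ hadj
        · change (SimpleGraph.boxProd _ _).Adj _ _ at hadj
          rw [SimpleGraph.boxProd_adj] at hadj
          rcases hadj with ⟨hadj, hi⟩ | ⟨hadj, hj⟩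
          · obtain rfl : i = i' := hi
            rw [SimpleGraph.pathGraph_adj] at hadj
            rcases hadj with hj | hj
            · exact ⟨_, 2 * j + 1, by have := j.2; omega,
                Or.inr (Or.inl ⟨j, j', i, hj.symm, rfl, rfl, rfl⟩)⟩
            · rw [Sym2.eq_swap]
              exact ⟨_, 2 * j' + 1, by have := j'.2; omega,
                Or.inr (Or.inl ⟨j', j, i, hj.symm, rfl, rfl, rfl⟩)⟩
          · obtain rfl : j = j' := hj
            rw [SimpleGraph.cycleGraph_adj'] at hadj
            have hone : ∀ x y : Fin n, (x - y).val = 1 → x = y + 1 := by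
              intro x y hxy
              rw [← sub_eq_iff_eq_add']
              apply Fin.ext
              rw [hxy, Fin.val_one', Nat.mod_eq_of_lt (by omega)]
            rcases hadj with hi | hi
            · rw [Sym2.eq_swap]
              have hi : i = i' + 1 := hone _ _ hi
              exact ⟨_, 2 * j, by have := j.2; omega, Or.inl ⟨j, i', rfl, rfl, by rw [hi]⟩⟩
            · have hi : i' = i + 1 := hone _ _ hi
              exact ⟨_, 2 * j, by have := j.2; omega, Or.inl ⟨j, i, rfl, rfl, by rw [hi]⟩⟩
    have hRfun : ∀ s k e e', R s k e → R s k e' → e = e' := by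
      rintro s k e e' (⟨j, i, hk, hs, rfl⟩ | ⟨j, j', i, hj, hk, hs, rfl⟩ | ⟨j, i, hj, hk, ha, rfl⟩)
        (⟨l, i', hk', hs', rfl⟩ | ⟨l, l', i', hl, hk', hs', rfl⟩ | ⟨l, i', hl, hk', ha', rfl⟩)
      · obtain rfl : j = l := Fin.ext (by omega)
        obtain rfl : i = i' := (Prod.ext_iff.1 (ht_inj (j, i) (j, i') rfl (hs.trans hs'.symm))).2
        rfl
      · omega
      · have := j.2; omega
      · omega
      · obtain rfl : j = l := Fin.ext (by omega)
        obtain rfl : j' = l' := Fin.ext (by omega)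
        obtain rfl : i = i' := (Prod.ext_iff.1 (ht_inj (j, i) (j, i') rfl (hs.trans hs'.symm))).2
        rfl
      · have := j'.2; omega
      · have := l.2; omega
      · have := l'.2; omega
      · obtain rfl : j = l := Fin.ext (by omega)
        have := ht_inj (j, i) (j, i') rfl (hinj _ _ (by rw [ha, ha', sub_self]; exact H.zero_mem))
        obtain rfl : i = i' := (Prod.ext_iff.1 this).2
        rfl
    constructor
    · rintro ⟨e, he⟩ ⟨e', he'⟩ heq
      obtain ⟨s, k, hk, hR⟩ := hRtot e he
      obtain ⟨s', k', hk', hR'⟩ := hRtot e' he'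
      have heq : inducedLabel f e = inducedLabel f e' := heq
      rw [hRlabel _ _ _ hR, hRlabel _ _ _ hR'] at heq
      obtain ⟨rfl, rfl⟩ := hbinj _ _ _ _ hk hk' heq
      exact Subtype.ext (hRfun _ _ _ _ hR hR')
    · intro g
      obtain ⟨s, k, hk, rfl⟩ := hbsurj g
      obtain ⟨e, he, hR⟩ := hRex s k hk
      exact ⟨⟨e, he⟩, hRlabel _ _ _ hR⟩

/-! ### Weaving: lifting a sequence through a small subgroup -/

theorem WPath.ofSeq {G : Type*} [Add G] (a : ℕ → G) (n : ℕ) :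
    WPath (a 0) (a n) {y | ∃ i ≤ n, a i = y} {s | ∃ i < n, a i + a (i + 1) = s} (n + 1) := by
  induction n with
  | zero => exact (WPath.single (a 0)).mono (by rintro y ⟨i, hi, rfl⟩; simp_all) (by rintro s ⟨i, hi, -⟩; omega)
  | succ n ih =>
    refine (ih.snoc (a (n + 1))).mono ?_ ?_
    · rintro y ⟨i, hi, rfl⟩
      rcases hi.lt_or_eq with hi | rfl
      · exact Or.inr ⟨i, by omega, rfl⟩
      · exact Or.inl rfl
    · rintro y ⟨i, hi, rfl⟩
      rcases (Nat.lt_succ_iff.1 hi).lt_or_eq with hi | rfl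
      · exact Or.inr ⟨i, by omega, rfl⟩
      · exact Or.inl rfl

/-- A walk through all translates by `A` of the terms of a sequence that is harmonious modulo the
image of `A` shows that the sequence can be lifted. -/
theorem WPath.harmMod_bot {G A : Type*} [AddCommGroup G] [AddCommGroup A] {H : AddSubgroup G}
    {N n : ℕ} (θ : A →+ G) (a : ℕ → G) (hH : H.index = N)
    (h₁ : ∀ q, ∃ i < n + 1, a i - q ∈ H ⊔ θ.range)
    (h₂ : ∀ i < n + 1, (∃ j, j + 1 < n + 1 ∧ a j + a (j + 1) - a i ∈ θ.range) ∨
      a n + a 0 - a i ∈ θ.range) {u v : G} {V S : Set G} (h : WPath u v V S N)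
    (hV : ∀ i ≤ n, ∀ c, a i + θ c ∈ V)
    (hS : ∀ i < n, ∀ c, a i + a (i + 1) + θ c ∈ insert (v + u) S)
    (hS' : ∀ c, a n + a 0 + θ c ∈ insert (v + u) S) : HarmMod H ⊥ N := by
  refine WPath.harmMod (h.mono (V' := {y | ∃ i ≤ n, ∃ c, y = a i + θ c}) ?_ le_rfl)
    (by rwa [sup_bot_eq]) (fun q => ?_) ?_
  · rintro y ⟨i, hi, c, rfl⟩
    exact hV i hi c
  · obtain ⟨i, hi, hq⟩ := h₁ q
    obtain ⟨x, hx, y, ⟨c, rfl⟩, e⟩ := AddSubgroup.mem_sup.1 hq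
    refine ⟨a i + θ (-c), ⟨i, by omega, -c, rfl⟩, ?_⟩
    rw [sup_bot_eq, map_neg]
    have : a i + -θ c - q = x := by rw [eq_sub_of_add_eq e]; abel
    rwa [this]
  · rintro y ⟨i, hi, c, rfl⟩
    rcases h₂ i (by omega) with ⟨j, hj, d, hd⟩ | ⟨d, hd⟩
    · refine ⟨_, hS j (by omega) (c - d), ?_⟩
      rw [AddSubgroup.mem_bot, map_sub, hd]
      abel
    · refine ⟨_, hS' (c - d), ?_⟩
      rw [AddSubgroup.mem_bot, map_sub, hd]
      abel

/-- Run through the sequence `p` times, translated by `θ 0, θ 1, …`, and concatenate. Inside the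
`c`-th copy the sums are shifted by `2c`, at the joins by `2c + 1`; both cover `ZMod p` because 2 is
invertible. -/
theorem HarmMod.weave_odd {G : Type*} [AddCommGroup G] {H : AddSubgroup G} {n p : ℕ}
    (hp : Odd p) (θ : ZMod p →+ G) (hn : n ≠ 0) (hH : H.index = n * p)
    (h : HarmMod H θ.range n) : HarmMod H ⊥ (n * p) := by
  obtain ⟨n, rfl⟩ := Nat.exists_eq_succ_of_ne_zero hn
  obtain ⟨a, h₁, h₂⟩ := h
  simp only [Nat.succ_eq_add_one, Nat.add_sub_cancel] at h₁ h₂ hH ⊢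
  have hadd : ∀ x y c d, x + θ c + (y + θ d) = x + y + θ (c + d) := fun x y c d => by
    rw [add_add_add_comm, ← map_add]
  obtain ⟨k, rfl⟩ := hp
  have hw : ∀ l : ℕ, WPath (a 0 + θ 0) (a n + θ l)
      {y | ∃ i ≤ n, ∃ c ≤ l, a i + θ (c : ℕ) = y}
      {s | (∃ i < n, ∃ c ≤ l, a i + a (i + 1) + θ (2 * (c : ℕ)) = s) ∨
        ∃ c < l, a n + a 0 + θ (2 * (c : ℕ) + 1) = s} ((n + 1) * (l + 1)) := by
    intro l
    induction l with
    | zero =>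
      have := WPath.ofSeq (fun i => a i + θ (0 : ℕ)) n
      simp only [Nat.cast_zero, zero_add, mul_one] at this ⊢
      refine this.mono ?_ ?_
      · rintro y ⟨i, hi, c, hc, rfl⟩
        obtain rfl : c = 0 := by omega
        exact ⟨i, hi, by simp⟩
      · rintro s (⟨i, hi, c, hc, rfl⟩ | ⟨c, hc, -⟩)
        · obtain rfl : c = 0 := by omega
          exact ⟨i, hi, by simp⟩
        · omega
    | succ l ih =>
      refine (ih.append (WPath.ofSeq (fun i => a i + θ (l + 1 : ℕ)) n)).mono ?_ ?_
      · rintro y ⟨i, hi, c, hc, rfl⟩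
        rcases hc.lt_or_eq with hc | rfl
        · exact Or.inl ⟨i, hi, c, by omega, rfl⟩
        · exact Or.inr ⟨i, hi, rfl⟩
      · rintro s (⟨i, hi, c, hc, rfl⟩ | ⟨c, hc, rfl⟩)
        · rcases hc.lt_or_eq with hc | rfl
          · exact Or.inr (Or.inl (Or.inl ⟨i, hi, c, by omega, rfl⟩))
          · exact Or.inr (Or.inr ⟨i, hi, by rw [hadd, two_mul (Nat.cast (l + 1))]⟩)
        · rcases (Nat.lt_succ_iff.1 hc).lt_or_eq with hc | rfl
          · exact Or.inr (Or.inl (Or.inr ⟨c, hc, rfl⟩))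
          · refine Or.inl ?_
            rw [hadd, Nat.cast_succ, two_mul (Nat.cast c), add_assoc (Nat.cast c)]
  have hval : ∀ c : ZMod (2 * k + 1), ∃ l ≤ 2 * k, (l : ZMod (2 * k + 1)) = c := fun c =>
    ⟨c.val, Nat.lt_succ_iff.1 (ZMod.val_lt c), ZMod.natCast_zmod_val c⟩
  have h2 : (2 : ZMod (2 * k + 1)) * (k + 1) = 1 := by
    have : ((2 * k + 1 : ℕ) : ZMod (2 * k + 1)) = 0 := ZMod.natCast_self _
    push_cast at this
    linear_combination this
  have hhalf : ∀ c : ZMod (2 * k + 1), ∃ l ≤ 2 * k, 2 * (l : ZMod (2 * k + 1)) = c := fun c => by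
    obtain ⟨l, hl, e⟩ := hval ((k + 1) * c)
    exact ⟨l, hl, by rw [e, ← mul_assoc, h2, one_mul]⟩
  refine WPath.harmMod_bot θ a hH h₁ h₂ (hw (2 * k)) ?_ ?_ ?_
  · intro i hi c
    obtain ⟨l, hl, rfl⟩ := hval c
    exact ⟨i, hi, l, hl, rfl⟩
  · intro i hi c
    obtain ⟨l, hl, rfl⟩ := hhalf c
    exact Or.inr (Or.inl ⟨i, hi, l, hl, rfl⟩)
  · intro c
    obtain ⟨l, hl, e⟩ := hhalf (c - 1)
    obtain rfl := eq_add_of_sub_eq e.symm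
    rcases hl.lt_or_eq with hl | rfl
    · exact Or.inr (Or.inr ⟨l, hl, rfl⟩)
    -- The closing sum is shifted by `2k`, which is the missing value `2(2k) + 1` modulo `2k + 1`.
    · left
      rw [hadd]
      congr 2
      have : ((2 * k + 1 : ℕ) : ZMod (2 * k + 1)) = 0 := ZMod.natCast_self _
      push_cast at this ⊢
      linear_combination this

/-- The automorphism of order three of the four-group. -/
def rot3 (x : ZMod 2 × ZMod 2) : ZMod 2 × ZMod 2 := (x.2, x.1 + x.2)

/-- Doubling vanishes on the four-group, so the shift must vary along a copy. With `ρ = rot3` one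
has `x + ρ x = ρ² x`, so the shifts `x, ρ x, ρ² x, ρ x, …` make both the shifts and their
consecutive sums bijective in `x` at each place. Only the four translates of `a 0` are handled
separately. -/
theorem HarmMod.weave_four_group {G : Type*} [AddCommGroup G] {H : AddSubgroup G} {n : ℕ}
    (θ : ZMod 2 × ZMod 2 →+ G) (hn : Even n) (hn4 : 4 ≤ n) (hH : H.index = n * 4)
    (h : HarmMod H θ.range n) : HarmMod H ⊥ (n * 4) := by
  obtain ⟨q, rfl⟩ : ∃ q, n = 2 * q + 3 + 1 := by
    obtain ⟨r, rfl⟩ := hn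
    exact ⟨r - 2, by omega⟩
  obtain ⟨a, h₁, h₂⟩ := h
  simp only [Nat.add_sub_cancel] at h₂
  have hadd : ∀ x y c d, x + θ c + (y + θ d) = x + y + θ (c + d) := fun x y c d => by
    rw [add_add_add_comm, ← map_add]
  let lab : ZMod 2 × ZMod 2 → ℕ → ZMod 2 × ZMod 2 := fun x j =>
    if j = 0 then x else if Odd j then rot3 x else rot3 (rot3 x)
  have hodd : ∀ x j, lab x (2 * j + 1) = rot3 x := fun x j => by simp [lab]
  have heven : ∀ x j, lab x (2 * j + 2) = rot3 (rot3 x) := fun x j => by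
    simp [lab, Nat.odd_add]
  have hr : ∀ x, ∃ y, rot3 y = x := by decide
  have hrr : ∀ x, ∃ y, rot3 (rot3 y) = x := by decide
  have hr2 : ∀ x, ∃ y, y + rot3 y = x := by decide
  have hr3 : ∀ x, ∃ y, rot3 y + rot3 (rot3 y) = x := by decide
  have strand : ∀ x, WPath (a 1 + θ x) (a (2 * q + 3) + θ (rot3 (rot3 x)))
      {y | ∃ i ≤ 2 * q + 2, a (i + 1) + θ (lab x i) = y}
      {s | ∃ i < 2 * q + 2, a (i + 1) + a (i + 2) + θ (lab x i + lab x (i + 1)) = s}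
      (2 * q + 3) := fun x => by
    have := WPath.ofSeq (fun i => a (i + 1) + θ (lab x i)) (2 * q + 2)
    simp only [hadd, heven] at this
    exact this
  -- Alternate strands are reversed, and translates of `a 0` are inserted between them. The eight
  -- joins give each shift of `a 0 + a 1` and of `a 0 + a (n - 1)` once, as the identities `v1`–`v8`
  -- record.
  have hcyc := (((((strand 0).append ((strand (0, 1)).reverse.cons (a 0 + θ (0, 1)))).append
    ((strand (1, 1)).cons (a 0 + θ (1, 0)))).append
    ((strand (1, 0)).reverse.cons (a 0 + θ (1, 1))))).cons (a 0 + θ 0)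
  simp only [hadd] at hcyc
  have hlab : ∀ c i, ∃ y, lab y i = c := by
    intro c i
    simp only [lab]
    split_ifs
    · exact ⟨c, rfl⟩
    · exact hr c
    · exact hrr c
  have hlab2 : ∀ c i, ∃ y, lab y i + lab y (i + 1) = c := by
    intro c i
    rcases Nat.even_or_odd' i with ⟨j, rfl | rfl⟩
    · simp only [hodd]
      rcases Nat.eq_zero_or_pos j with rfl | hj
      · exact hr2 c
      · obtain ⟨j, rfl⟩ := Nat.exists_eq_succ_of_ne_zero hj.ne'
        simp only [Nat.succ_eq_add_one, mul_add, mul_one, heven]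
        simp only [add_comm (rot3 (rot3 _))]
        exact hr3 c
    · simp only [hodd, heven]
      exact hr3 c
  have h4 : ∀ y : ZMod 2 × ZMod 2, y = 0 ∨ y = (0, 1) ∨ y = (1, 1) ∨ y = (1, 0) := by decide
  have v1 : 0 + 0 = (0 : ZMod 2 × ZMod 2) := by decide
  have v2 : rot3 (rot3 (1, 1)) + (1, 1) = (1, 0) := by decide
  have v3 : ((0, 1) : ZMod 2 × ZMod 2) + (1, 0) = (1, 1) := by decide
  have v4 : rot3 (rot3 0) + (0, 1) = (0, 1) := by decide
  have v5 : (0, 1) + rot3 (rot3 (0, 1)) = (1, 1) := by decide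
  have v6 : ((1, 0) : ZMod 2 × ZMod 2) + (1, 1) = (0, 1) := by decide
  have v7 : (1, 1) + rot3 (rot3 (1, 0)) = 0 := by decide
  have v8 : ((1, 0) : ZMod 2 × ZMod 2) + 0 = (1, 0) := by decide
  rw [show 2 * q + 3 + (2 * q + 3 + 1) + (2 * q + 3 + 1) + (2 * q + 3 + 1) + 1 =
    (2 * q + 3 + 1) * 4 by ring] at hcyc
  refine WPath.harmMod_bot θ a hH h₁ h₂ hcyc ?_ ?_ ?_
  · intro i hi c
    rcases Nat.eq_zero_or_pos i with rfl | hi0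
    · rcases h4 c with rfl | rfl | rfl | rfl <;> simp
    · obtain ⟨i, rfl⟩ := Nat.exists_eq_succ_of_ne_zero hi0.ne'
      obtain ⟨y, rfl⟩ := hlab c i
      have hm : a (i + 1) + θ (lab y i) ∈
          {z | ∃ i ≤ 2 * q + 2, a (i + 1) + θ (lab y i) = z} := ⟨i, by omega, rfl⟩
      simp only [Set.mem_insert_iff, Set.mem_union]
      rcases h4 y with rfl | rfl | rfl | rfl <;> simp only [hm, true_or, or_true]
  · intro i hi c
    rcases Nat.eq_zero_or_pos i with rfl | hi0
    · have e : ∀ t, a 0 + a 1 + t = a 1 + a 0 + t := fun t => by rw [add_comm (a 0)]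
      simp only [zero_add, e, hadd, Set.mem_insert_iff, Set.mem_union, v1, v2, v3, v4, v5, v6, v7, v8]
      rcases h4 c with rfl | rfl | rfl | rfl <;> simp only [true_or, or_true]
    · obtain ⟨i, rfl⟩ := Nat.exists_eq_succ_of_ne_zero hi0.ne'
      obtain ⟨y, rfl⟩ := hlab2 c i
      have hm : a (i + 1) + a (i + 2) + θ (lab y i + lab y (i + 1)) ∈
          {z | ∃ i < 2 * q + 2, a (i + 1) + a (i + 2) + θ (lab y i + lab y (i + 1)) = z} :=
        ⟨i, by omega, rfl⟩
      simp only [Set.mem_insert_iff, Set.mem_union, Nat.succ_eq_add_one, add_assoc, Nat.reduceAdd]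
      simp only [add_assoc] at hm
      rcases h4 y with rfl | rfl | rfl | rfl <;> simp only [hm, true_or, or_true]
  · intro c
    have e : ∀ t, a 0 + a (2 * q + 3) + t = a (2 * q + 3) + a 0 + t := fun t => by
      rw [add_comm (a 0)]
    simp only [e, hadd, Set.mem_insert_iff, Set.mem_union, v1, v2, v3, v4, v5, v6, v7, v8]
    rcases h4 c with rfl | rfl | rfl | rfl <;> simp only [true_or, or_true]

/-- On the stretch `a 1, …, a (n - 1)` a forward zigzag realises the three nonzero shifts of each
consecutive sum, and a plain return run realises shift 0. The translates of `a 0` and two leftover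
end terms close the cycle. -/
theorem HarmMod.weave_four {G : Type*} [AddCommGroup G] {H : AddSubgroup G} {n : ℕ}
    (θ : ZMod 4 →+ G) (hn : Even n) (hn0 : n ≠ 0) (hH : H.index = n * 4)
    (h : HarmMod H θ.range n) : HarmMod H ⊥ (n * 4) := by
  obtain ⟨q, rfl⟩ : ∃ q, n = 2 * q + 1 + 1 := by
    obtain ⟨r, rfl⟩ := hn
    exact ⟨r - 1, by omega⟩
  obtain ⟨a, h₁, h₂⟩ := h
  simp only [Nat.add_sub_cancel] at h₂
  have hadd : ∀ x y c d, x + θ c + (y + θ d) = x + y + θ (c + d) := fun x y c d => by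
    rw [add_add_add_comm, ← map_add]
  have h4 : ∀ y : ZMod 4, y = 0 ∨ y = 1 ∨ y = 2 ∨ y = 3 := by decide
  have w1 : 1 + 2 = (3 : ZMod 4) := by decide
  have w2 : 2 + 0 = (2 : ZMod 4) := by decide
  have w3 : 0 + 3 = (3 : ZMod 4) := by decide
  have w4 : 3 + 2 = (1 : ZMod 4) := by decide
  have w5 : 0 + 1 = (1 : ZMod 4) := by decide
  have w6 : 1 + 3 = (0 : ZMod 4) := by decide
  have w7 : 2 + 1 = (3 : ZMod 4) := by decide
  have w8 : 3 + 1 = (0 : ZMod 4) := by decide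
  -- Each block of six steps goes forward two places, back two and forward two, crossing each of its
  -- two gaps three times, with shifts 1, 2, 3.
  have zig : ∀ r : ℕ, WPath (a 1 + θ 1) (a (2 * r + 1) + θ 1)
      {z | z = a 1 + θ 1 ∨ ∃ i < r, a (2 * i + 2) + θ 2 = z ∨ a (2 * i + 3) + θ 0 = z ∨
        a (2 * i + 2) + θ 3 = z ∨ a (2 * i + 1) + θ 2 = z ∨ a (2 * i + 2) + θ 0 = z ∨
        a (2 * i + 3) + θ 1 = z}
      {s | ∃ i < 2 * r, ∃ c, c ≠ 0 ∧ a (i + 1) + a (i + 2) + θ c = s} (6 * r + 1) := by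
    intro r
    induction r with
    | zero => 
      refine (WPath.single (a 1 + θ 1)).mono ?_ ?_
      · rintro z (rfl | ⟨i, hi, -⟩)
        · rfl
        · omega
      · rintro z ⟨i, hi, -⟩
        omega
    | succ r ih =>
      refine ((((((ih.snoc (a (2 * r + 2) + θ 2)).snoc (a (2 * r + 3) + θ 0)).snoc
        (a (2 * r + 2) + θ 3)).snoc (a (2 * r + 1) + θ 2)).snoc (a (2 * r + 2) + θ 0)).snoc
        (a (2 * r + 3) + θ 1)).mono ?_ ?_
      · rintro z (rfl | ⟨i, hi, hz⟩)
        · simp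
        · rcases (Nat.lt_succ_iff.1 hi).lt_or_eq with hi | rfl
          · iterate 6 right
            exact Or.inr ⟨i, hi, hz⟩
          · simp only [Set.mem_insert_iff]
            tauto
      · have e : ∀ t, a (2 * r + 2) + a (2 * r + 1) + t = a (2 * r + 1) + a (2 * r + 2) + t :=
          fun t => by rw [add_comm (a (2 * r + 2))]
        have e' : ∀ t, a (2 * r + 3) + a (2 * r + 2) + t = a (2 * r + 2) + a (2 * r + 3) + t :=
          fun t => by rw [add_comm (a (2 * r + 3))]
        simp only [hadd, e, e', w1, w2, w3, w4, w5]
        rintro s ⟨i, hi, c, hc, rfl⟩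
        rcases Nat.lt_or_ge i (2 * r) with hi' | hi'
        · iterate 6 right
          exact ⟨i, hi', c, hc, rfl⟩
        · obtain rfl | rfl : i = 2 * r ∨ i = 2 * r + 1 := by omega
          · rcases h4 c with rfl | rfl | rfl | rfl
            · exact absurd rfl hc
            all_goals simp
          · rcases h4 c with rfl | rfl | rfl | rfl
            · exact absurd rfl hc
            all_goals simp [add_assoc]
  -- The shifts 3, 1, 3, … are those the zigzag omits at interior places; neighbouring ones add to
  -- 0.
  have hQ := WPath.ofSeq (fun i => a (i + 1) + θ (if Even i then 3 else 1)) (2 * q)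
  have hsum : ∀ i : ℕ, (if Even i then 3 else 1 : ZMod 4) + (if Even (i + 1) then 3 else 1) = 0 := by
    intro i
    rcases Nat.even_or_odd i with hi | hi
    · rw [if_pos hi, if_neg (by simpa [Nat.even_add_one] using hi)]; rfl
    · rw [if_neg (by simpa using hi), if_pos (by simpa [Nat.even_add_one] using hi)]; rfl
  simp only [hadd, hsum, even_two_mul, if_true, Even.zero] at hQ
  have hcyc := ((zig q).cons (a 0 + θ 2)).append (((((hQ.reverse.snoc (a 0 + θ 1)).snoc
    (a 1 + θ 0)).cons (a 0 + θ 0)).cons (a (2 * q + 1) + θ 2)).cons (a 0 + θ 3))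
  simp only [hadd] at hcyc
  rw [show 6 * q + 1 + 1 + (2 * q + 1 + 1 + 1 + 1 + 1 + 1) = (2 * q + 1 + 1) * 4 by ring] at hcyc
  have e1 : ∀ t, a 0 + a 1 + t = a 1 + a 0 + t := fun t => by rw [add_comm (a 0)]
  have e2 : ∀ t, a 0 + a (2 * q + 1) + t = a (2 * q + 1) + a 0 + t := fun t => by
    rw [add_comm (a 0)]
  refine WPath.harmMod_bot θ a hH h₁ h₂ hcyc ?_ ?_ ?_
  · intro i hi c
    have hodd : ∀ i ≤ 2 * q, Even i → a (i + 1) + θ 3 ∈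
        {y | ∃ i ≤ 2 * q, a (i + 1) + θ (if Even i then 3 else 1) = y} :=
      fun i hi he => ⟨i, hi, by rw [if_pos he]⟩
    have heven : ∀ i ≤ 2 * q, ¬ Even i → a (i + 1) + θ 1 ∈
        {y | ∃ i ≤ 2 * q, a (i + 1) + θ (if Even i then 3 else 1) = y} :=
      fun i hi he => ⟨i, hi, by rw [if_neg he]⟩
    simp only [Set.mem_insert_iff, Set.mem_union]
    rcases Nat.eq_zero_or_pos i with rfl | hi0
    · rcases h4 c with rfl | rfl | rfl | rfl <;> simp
    · obtain ⟨j, rfl | rfl⟩ : ∃ j, i = 2 * j + 1 ∨ i = 2 * j + 2 := ⟨(i - 1) / 2, by omega⟩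
      · rcases h4 c with rfl | rfl | rfl | rfl
        · rcases Nat.eq_zero_or_pos j with rfl | hj
          · simp
          · obtain ⟨k, rfl⟩ := Nat.exists_eq_succ_of_ne_zero hj.ne'
            exact Or.inl (Or.inr (Or.inr ⟨k, by omega, Or.inr (Or.inl rfl)⟩))
        · rcases Nat.eq_zero_or_pos j with rfl | hj
          · simp
          · obtain ⟨k, rfl⟩ := Nat.exists_eq_succ_of_ne_zero hj.ne'
            refine Or.inl (Or.inr (Or.inr ⟨k, by omega, ?_⟩))
            iterate 5 right
            rfl
        · rcases (show j ≤ q by omega).lt_or_eq with hj | rfl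
          · refine Or.inl (Or.inr (Or.inr ⟨j, hj, ?_⟩))
            iterate 3 right
            exact Or.inl rfl
          · exact Or.inr (Or.inr (Or.inl rfl))
        · right
          iterate 5 right
          exact hodd (2 * j) (by omega) (even_two_mul j)
      · rcases h4 c with rfl | rfl | rfl | rfl
        · refine Or.inl (Or.inr (Or.inr ⟨j, by omega, ?_⟩))
          iterate 4 right
          exact Or.inl rfl
        · right
          iterate 5 right
          exact heven (2 * j + 1) (by omega) (by simp)
        · exact Or.inl (Or.inr (Or.inr ⟨j, by omega, Or.inl rfl⟩))
        · exact Or.inl (Or.inr (Or.inr ⟨j, by omega, Or.inr (Or.inr (Or.inl rfl))⟩))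
  · intro i hi c
    simp only [Set.mem_insert_iff, Set.mem_union]
    rcases Nat.eq_zero_or_pos i with rfl | hi0
    · simp only [zero_add, add_zero, e1, hadd, w4, w6, w7, w8]
      rcases h4 c with rfl | rfl | rfl | rfl <;> simp only [true_or, or_true]
    · obtain ⟨i, rfl⟩ := Nat.exists_eq_succ_of_ne_zero hi0.ne'
      by_cases hc : c = 0
      · have : a (i + 1) + a (i + 2) + θ c ∈ {s | ∃ i < 2 * q, a (i + 1) + a (i + 1 + 1) + θ 0 = s} :=
          ⟨i, by omega, by rw [hc]⟩
        tauto
      · have : a (i + 1) + a (i + 2) + θ c ∈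
            {s | ∃ i < 2 * q, ∃ c, c ≠ 0 ∧ a (i + 1) + a (i + 2) + θ c = s} :=
          ⟨i, by omega, c, hc, rfl⟩
        tauto
  · intro c
    simp only [Set.mem_insert_iff, Set.mem_union, zero_add, add_zero, e2, hadd, w4, w6, w7,
      w8]
    rcases h4 c with rfl | rfl | rfl | rfl <;> simp only [true_or, or_true]

/-! ### Sequences in `ℤ × A` modulo `(2k, 0)`: boxes, zigzags and braids -/

theorem index_zmultiples_prod {A : Type*} [AddCommGroup A] (k : ℕ) :
    (AddSubgroup.zmultiples ((2 * k : ℤ), (0 : A))).index = 2 * k * Nat.card A := by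
  have : AddSubgroup.zmultiples ((2 * k : ℤ), (0 : A)) =
      (AddSubgroup.zmultiples (2 * k : ℤ)).prod ⊥ := by
    ext ⟨x, b⟩
    simp only [AddSubgroup.mem_zmultiples_iff, AddSubgroup.mem_prod, AddSubgroup.mem_bot,
      Prod.smul_mk, smul_zero, Prod.mk.injEq]
    constructor
    · rintro ⟨z, h, rfl⟩
      exact ⟨⟨z, h⟩, rfl⟩
    · rintro ⟨⟨z, h⟩, rfl⟩
      exact ⟨z, h, rfl⟩
  rw [this, AddSubgroup.index_prod, Int.index_zmultiples, AddSubgroup.index_bot]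
  simp [Int.natAbs_mul]

/-- A system of representatives of `ℤ × A` modulo `(2k, 0)`. -/
def box {A : Type*} (k : ℕ) (B : A → Prop) : Set (ℤ × A) :=
  {z | (-k < z.1 ∧ z.1 < k) ∨ (z.1 = k ∧ B z.2) ∨ (z.1 = -k ∧ ¬ B z.2)}

/-- The predicate `B` selects one of `(k, b)`, `(-k, b)` for each `b`. Both visits and sums are
matched to the box with no reduction of the integer coordinate, which turns every concrete case into
linear inequalities. -/
theorem WPath.harmMod_box {A : Type*} [AddCommGroup A] {k N : ℕ} (hk : 0 < k) (B : A → Prop)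
    {u v : ℤ × A} {V S : Set (ℤ × A)} (h : WPath u v V S N) (hN : N = 2 * k * Nat.card A)
    (hV : ∀ x b, (x, b) ∈ box k B → (x, b) ∈ V)
    (hS : ∀ x b, (x, b) ∈ box k B → (x, b) ∈ insert (v + u) S) :
    HarmMod (AddSubgroup.zmultiples ((2 * k : ℤ), (0 : A))) ⊥ (2 * k * Nat.card A) := by
  subst hN
  refine (h.mono (V' := box k B) (fun z hz => hV z.1 z.2 hz) le_rfl).harmMod ?_ ?_ ?_
  · rw [sup_bot_eq, index_zmultiples_prod]
  · rintro ⟨x, b⟩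
    rw [sup_bot_eq]
    have h1 := Int.emod_nonneg x (b := 2 * k) (by omega)
    have h2 := Int.emod_lt_of_pos x (b := 2 * k) (by omega)
    have h3 := Int.mul_ediv_add_emod x (2 * k)
    have key : ∀ y z : ℤ, y - x = z * (2 * k) → (y, b) ∈ box k B →
        ∃ y ∈ box k B, y - (x, b) ∈ AddSubgroup.zmultiples ((2 * k : ℤ), (0 : A)) := by
      intro y z hy hyb
      refine ⟨(y, b), hyb, z, ?_⟩
      ext <;> simp [hy]
    rcases lt_trichotomy (x % (2 * k)) k with hx | hx | hx
    · exact key (x % (2 * k)) (-(x / (2 * k))) (by linear_combination h3)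
        (Or.inl ⟨by dsimp; omega, hx⟩)
    · by_cases hb : B b
      · exact key (x % (2 * k)) (-(x / (2 * k))) (by linear_combination h3) (Or.inr (Or.inl ⟨hx, hb⟩))
      · exact key (x % (2 * k) - 2 * k) (-(x / (2 * k)) - 1) (by linear_combination h3)
          (Or.inr (Or.inr ⟨by dsimp; omega, hb⟩))
    · exact key (x % (2 * k) - 2 * k) (-(x / (2 * k)) - 1) (by linear_combination h3)
        (Or.inl ⟨by dsimp; omega, by dsimp; omega⟩)
  · rintro ⟨x, b⟩ hy
    exact ⟨_, hS x b hy, by simp⟩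

/-- The sequence `(X, a), (Y, b), (X - 1, a), (Y - 1, b), …`. -/
def zigzag {A : Type*} (X Y : ℤ) (a b : A) (j : ℕ) : ℤ × A :=
  if j % 2 = 0 then (X - (j / 2 : ℕ), a) else (Y - (j / 2 : ℕ), b)

theorem zigzag_even {A : Type*} (X Y : ℤ) (a b : A) (t : ℕ) : zigzag X Y a b (2 * t) = (X - t, a) := by
  simp [zigzag]

theorem zigzag_odd {A : Type*} (X Y : ℤ) (a b : A) (t : ℕ) :
    zigzag X Y a b (2 * t + 1) = (Y - t, b) := by
  simp [zigzag, Nat.add_mod, show (2 * t + 1) / 2 = t by omega]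

theorem wpath_zigzag {A : Type*} [AddCommGroup A] (X Y : ℤ) (a b : A) (n : ℕ) :
    WPath (X, a) (X - n, a)
      {z | (z.2 = a ∧ X - n ≤ z.1 ∧ z.1 ≤ X) ∨ (z.2 = b ∧ Y - n < z.1 ∧ z.1 ≤ Y)}
      {z | z.2 = a + b ∧ X + Y - 2 * n < z.1 ∧ z.1 ≤ X + Y} (2 * n + 1) := by
  have h := WPath.ofSeq (zigzag X Y a b) (2 * n)
  rw [zigzag_even, show zigzag X Y a b 0 = (X, a) by simp [zigzag]] at h
  refine h.mono ?_ ?_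
  · rintro ⟨x, c⟩ (⟨hc, h1, h2⟩ | ⟨hc, h1, h2⟩) <;> dsimp only at hc h1 h2 <;> subst hc
    · refine ⟨2 * (X - x).toNat, by omega, ?_⟩
      rw [zigzag_even, Int.toNat_of_nonneg (by omega), sub_sub_cancel]
    · refine ⟨2 * (Y - x).toNat + 1, by omega, ?_⟩
      rw [zigzag_odd, Int.toNat_of_nonneg (by omega), sub_sub_cancel]
  · rintro ⟨x, c⟩ ⟨hc, h1, h2⟩
    dsimp only at hc h1 h2
    subst hc
    refine ⟨(X + Y - x).toNat, by omega, ?_⟩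
    rcases Int.even_or_odd' (X + Y - x) with ⟨t, ht | ht⟩
    · rw [show (X + Y - x).toNat = 2 * t.toNat by omega, zigzag_even, zigzag_odd, Prod.mk_add_mk,
        Int.toNat_of_nonneg (by omega)]
      congr 1
      omega
    · rw [show (X + Y - x).toNat = 2 * t.toNat + 1 by omega, zigzag_odd,
        show 2 * t.toNat + 1 + 1 = 2 * (t.toNat + 1) by ring, zigzag_even, Prod.mk_add_mk, add_comm a]
      congr 1
      push_cast
      rw [Int.toNat_of_nonneg (by omega)]
      omega

/-- The sequence `(X, p), (Y, q), (X - 1, r), (Y, s), (X - 2, p), (Y - 2, q), …`. -/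
def braid {A : Type*} (X Y : ℤ) (p q r s : A) (j : ℕ) : ℤ × A :=
  if j % 4 = 0 then (X - 2 * (j / 4 : ℕ), p) else if j % 4 = 1 then (Y - 2 * (j / 4 : ℕ), q) else
    if j % 4 = 2 then (X - 1 - 2 * (j / 4 : ℕ), r) else (Y - 2 * (j / 4 : ℕ), s)

section

variable {A : Type*} (X Y : ℤ) (p q r s : A)

theorem braid_at_zero : braid X Y p q r s 0 = (X, p) := by
  simp [braid]

theorem braid_at_one : braid X Y p q r s 1 = (Y, q) := by
  simp [braid]

theorem braid_zero (t : ℕ) : braid X Y p q r s (4 * t) = (X - 2 * t, p) := by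
  simp [braid]

theorem braid_one (t : ℕ) : braid X Y p q r s (4 * t + 1) = (Y - 2 * t, q) := by
  simp [braid, Nat.add_mod, show (4 * t + 1) / 4 = t by omega]

theorem braid_two (t : ℕ) : braid X Y p q r s (4 * t + 2) = (X - 1 - 2 * t, r) := by
  simp [braid, Nat.add_mod, show (4 * t + 2) / 4 = t by omega]

theorem braid_three (t : ℕ) : braid X Y p q r s (4 * t + 3) = (Y - 2 * t, s) := by
  simp [braid, Nat.add_mod, show (4 * t + 3) / 4 = t by omega]

/-- One period has sums at heights `X + Y`, `X + Y - 1` twice, and `X + Y - 2`, after which the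
height drops by 4 in all. A braid with `X` and `Y` both lowered by one therefore fills the gaps. The
offset `lo` allows a start inside the first period. -/
theorem wpath_braid [AddCommGroup A] (lo n : ℕ) :
    WPath (braid X Y p q r s lo) (braid X Y p q r s (lo + n))
      {z | (z.2 = p ∧ 2 ∣ X - z.1 ∧ lo ≤ 2 * (X - z.1) ∧ 2 * (X - z.1) ≤ lo + n) ∨
        (z.2 = q ∧ 2 ∣ Y - z.1 ∧ lo ≤ 2 * (Y - z.1) + 1 ∧ 2 * (Y - z.1) + 1 ≤ lo + n) ∨
        (z.2 = r ∧ 2 ∣ X - 1 - z.1 ∧ lo ≤ 2 * (X - z.1) ∧ 2 * (X - z.1) ≤ lo + n) ∨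
        (z.2 = s ∧ 2 ∣ Y - z.1 ∧ lo ≤ 2 * (Y - z.1) + 3 ∧ 2 * (Y - z.1) + 3 ≤ lo + n)}
      {z | (z.2 = p + q ∧ 4 ∣ X + Y - z.1 ∧ lo ≤ X + Y - z.1 ∧ X + Y - z.1 < lo + n) ∨
        (z.2 = q + r ∧ 4 ∣ X + Y - z.1 - 1 ∧ lo ≤ X + Y - z.1 ∧ X + Y - z.1 < lo + n) ∨
        (z.2 = r + s ∧ 4 ∣ X + Y - z.1 - 1 ∧ lo ≤ X + Y - z.1 + 1 ∧ X + Y - z.1 + 1 < lo + n) ∨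
        (z.2 = s + p ∧ 4 ∣ X + Y - z.1 - 2 ∧ lo ≤ X + Y - z.1 + 1 ∧ X + Y - z.1 + 1 < lo + n)}
      (n + 1) := by
  refine (WPath.ofSeq (fun j => braid X Y p q r s (lo + j)) n).mono ?_ ?_
  · have key : ∀ (z : ℤ × A) (j : ℕ), lo ≤ j → j ≤ lo + n → braid X Y p q r s j = z →
        ∃ i ≤ n, braid X Y p q r s (lo + i) = z := fun z j h1 h2 h3 =>
      ⟨j - lo, by omega, by rw [Nat.add_sub_cancel' h1, h3]⟩
    rintro ⟨x, c⟩ (⟨hc, ⟨t, ht⟩, h1, h2⟩ | ⟨hc, ⟨t, ht⟩, h1, h2⟩ | ⟨hc, ⟨t, ht⟩, h1, h2⟩ |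
      ⟨hc, ⟨t, ht⟩, h1, h2⟩) <;> dsimp only at hc ht h1 h2 <;> subst hc <;>
      lift t to ℕ using by omega
    · refine key _ (4 * t) (by omega) (by omega) ?_
      rw [braid_zero, ← ht, sub_sub_cancel]
    · refine key _ (4 * t + 1) (by omega) (by omega) ?_
      rw [braid_one, ← ht, sub_sub_cancel]
    · refine key _ (4 * t + 2) (by omega) (by omega) ?_
      rw [braid_two, ← ht, sub_sub_cancel]
    · refine key _ (4 * t + 3) (by omega) (by omega) ?_
      rw [braid_three, ← ht, sub_sub_cancel]
  · have key : ∀ (z : ℤ × A) (j : ℕ), lo ≤ j → j < lo + n →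
        braid X Y p q r s j + braid X Y p q r s (j + 1) = z →
        ∃ i < n, braid X Y p q r s (lo + i) + braid X Y p q r s (lo + (i + 1)) = z :=
      fun z j h1 h2 h3 => ⟨j - lo, by omega, by
        rw [← add_assoc, Nat.add_sub_cancel' h1, h3]⟩
    rintro ⟨x, c⟩ (⟨hc, ⟨t, ht⟩, h1, h2⟩ | ⟨hc, ⟨t, ht⟩, h1, h2⟩ | ⟨hc, ⟨t, ht⟩, h1, h2⟩ |
      ⟨hc, ⟨t, ht⟩, h1, h2⟩) <;> dsimp only at hc ht h1 h2 <;> subst hc <;>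
      lift t to ℕ using by omega
    · refine key _ (4 * t) (by omega) (by omega) ?_
      rw [braid_zero, braid_one, Prod.mk_add_mk]
      congr 1
      omega
    · refine key _ (4 * t + 1) (by omega) (by omega) ?_
      rw [braid_one, braid_two, Prod.mk_add_mk]
      congr 1
      omega
    · refine key _ (4 * t + 2) (by omega) (by omega) ?_
      rw [braid_two, braid_three, Prod.mk_add_mk]
      congr 1
      omega
    · refine key _ (4 * t + 3) (by omega) (by omega) ?_
      rw [braid_three, show 4 * t + 3 + 1 = 4 * (t + 1) by ring, braid_zero, Prod.mk_add_mk]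
      congr 1
      push_cast
      omega

end

/-! ### Base cycles for `A` of order two -/

set_option linter.unusedSimpArgs false
set_option linter.unusedTactic false

theorem zmod_two_cases (b : ZMod 2) : b = 0 ∨ b = 1 := by
  revert b
  decide

/-- Two complementary braids cover all but six elements of the box; those six, near `0` and `±k`,
supply the remaining sums. -/
theorem harmMod_box_even (K : ℕ) :
    HarmMod (AddSubgroup.zmultiples ((2 * (2 * K + 2 : ℕ) : ℤ), (0 : ZMod 2))) ⊥
      (2 * (2 * K + 2) * Nat.card (ZMod 2)) := by
  have h1 := wpath_braid (2 * K + 2) (-1) 0 0 1 (1 : ZMod 2) 0 (4 * K)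
  have h2 := wpath_braid (2 * K + 1) (-2) 0 0 1 (1 : ZMod 2) 0 (4 * K)
  rw [zero_add, braid_zero, braid_at_zero] at h1 h2
  have h3 := (WPath.single ((-(2 * K + 2), 1) : ℤ × ZMod 2)).snoc (0, 0)
  have h4 := (((WPath.single ((-(2 * K + 1), 0) : ℤ × ZMod 2)).snoc (1, 1)).snoc
    (-(2 * K + 1), 1)).snoc (0, 1)
  have h := ((h1.append h4).append h2).append h3
  refine WPath.harmMod_box (by omega) (fun b => b = 0) h ?_ ?_ ?_
  · rw [Nat.card_zmod]
    ring
  · rintro x b hx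
    simp only [box, Set.mem_ofPred_eq] at hx
    simp only [Set.mem_union, Set.mem_insert_iff, Set.mem_ofPred_eq, Set.mem_singleton_iff,
      Set.mem_empty_iff_false, Prod.mk_add_mk, Prod.mk.injEq]
    rcases zmod_two_cases b with rfl | rfl <;>
      simp (decide := true) only [zero_add, add_zero, not_true, not_false_iff, and_false, false_and,
        or_false, false_or, true_and, and_true, eq_self] at hx ⊢ <;>
      push_cast at hx ⊢ <;> omega
  · rintro x b hx
    simp only [box, Set.mem_ofPred_eq] at hx
    simp only [Set.mem_union, Set.mem_insert_iff, Set.mem_ofPred_eq, Set.mem_singleton_iff,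
      Set.mem_empty_iff_false, Prod.mk_add_mk, Prod.mk.injEq]
    rcases zmod_two_cases b with rfl | rfl <;>
      simp (decide := true) only [zero_add, add_zero, not_true, not_false_iff, and_false, false_and,
        or_false, false_or, true_and, and_true, eq_self] at hx ⊢ <;>
      push_cast at hx ⊢ <;> omega

/-- The walk alternates between two blocks of integers about `k` apart. Each inductive step enlarges
both blocks by one, adding three terms at one end and one at the other, and yields both labels at
the next two heights of the sums. The reversal restores the orientation. -/
theorem wpath_turn_left (k c : ℤ) (r : ℕ) :
    WPath ((-c + r, 0) : ℤ × ZMod 2) (k - c + r, 0)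
      {z | (-c ≤ z.1 ∧ z.1 ≤ -c + r) ∨ (k - c < z.1 ∧ z.1 ≤ k - c + r) ∨ (z.1 = k - c ∧ z.2 = 0)}
      {z | (k - 2 * c + 1 ≤ z.1 ∧ z.1 ≤ k - 2 * c + 2 * r) ∨
        ((z.1 = -2 * c ∨ z.1 = k - 2 * c) ∧ z.2 = 1)} (4 * r + 3) := by
  induction r with
  | zero =>
    have h := ((WPath.single ((-c, 0) : ℤ × ZMod 2)).snoc (-c, 1)).snoc (k - c, 0)
    simp only [Nat.cast_zero, add_zero]
    refine h.mono ?_ ?_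
    · rintro ⟨x, b⟩ hx
      simp only [Set.mem_ofPred_eq] at hx
      simp only [Set.mem_union, Set.mem_insert_iff, Set.mem_ofPred_eq, Set.mem_singleton_iff,
        Set.mem_empty_iff_false, Prod.mk_add_mk, Prod.mk.injEq]
      rcases zmod_two_cases b with rfl | rfl <;>
        simp (decide := true) only [zero_add, add_zero, not_true, not_false_iff, and_false,
          false_and, or_false, false_or, true_and, and_true, eq_self] at hx ⊢ <;>
        push_cast at hx ⊢ <;> omega
    · rintro ⟨x, b⟩ hx
      simp only [Set.mem_ofPred_eq] at hx
      simp only [Set.mem_union, Set.mem_insert_iff, Set.mem_ofPred_eq, Set.mem_singleton_iff,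
        Set.mem_empty_iff_false, Prod.mk_add_mk, Prod.mk.injEq]
      rcases zmod_two_cases b with rfl | rfl <;>
        simp (decide := true) only [zero_add, add_zero, not_true, not_false_iff, and_false,
          false_and, or_false, false_or, true_and, and_true, eq_self] at hx ⊢ <;>
        push_cast at hx ⊢ <;> omega
  | succ r ih =>
    have h := (((ih.reverse.cons (-c + (r + 1 : ℕ), 1)).cons (k - c + (r + 1 : ℕ), 1)).cons
      (-c + (r + 1 : ℕ), 0)).snoc (k - c + (r + 1 : ℕ), 0)
    refine h.mono ?_ ?_
    · rintro ⟨x, b⟩ hx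
      simp only [Set.mem_ofPred_eq] at hx
      simp only [Set.mem_union, Set.mem_insert_iff, Set.mem_ofPred_eq, Set.mem_singleton_iff,
        Set.mem_empty_iff_false, Prod.mk_add_mk, Prod.mk.injEq]
      rcases zmod_two_cases b with rfl | rfl <;>
        simp (decide := true) only [zero_add, add_zero, not_true, not_false_iff, and_false,
          false_and, or_false, false_or, true_and, and_true, eq_self] at hx ⊢ <;>
        push_cast at hx ⊢ <;> omega
    · rintro ⟨x, b⟩ hx
      simp only [Set.mem_ofPred_eq] at hx
      simp only [Set.mem_union, Set.mem_insert_iff, Set.mem_ofPred_eq, Set.mem_singleton_iff,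
        Set.mem_empty_iff_false, Prod.mk_add_mk, Prod.mk.injEq]
      rcases zmod_two_cases b with rfl | rfl <;>
        simp (decide := true) only [zero_add, add_zero, not_true, not_false_iff, and_false,
          false_and, or_false, false_or, true_and, and_true, eq_self] at hx ⊢ <;>
        push_cast at hx ⊢ <;> omega

/-- The downward counterpart of `wpath_turn_left`. The end label `e` is 0 for `r = 0` and 1
afterwards; only the relation between the two ends is carried along. -/
theorem wpath_turn_right (k d : ℤ) (r : ℕ) :
    ∃ e, WPath ((k - d - r, e) : ℤ × ZMod 2) (-d - r, e + 1)
      {z | (k - d - r ≤ z.1 ∧ z.1 ≤ k - d) ∨ (-d - r ≤ z.1 ∧ z.1 ≤ -d) ∨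
        (z.1 = k - d + 1 ∧ z.2 = 1)}
      {z | (k - 2 * d - 2 * r ≤ z.1 ∧ z.1 ≤ k - 2 * d) ∨
        ((z.1 = 2 * k - 2 * d + 1 ∨ z.1 = k - 2 * d + 1) ∧ z.2 = 0)} (4 * r + 5) := by
  induction r with
  | zero =>
    have h := ((((WPath.single ((k - d, 0) : ℤ × ZMod 2)).snoc (-d, 0)).snoc (k - d, 1)).snoc
      (k - d + 1, 1)).snoc (-d, 1)
    refine ⟨0, ?_⟩
    simp only [Nat.cast_zero, sub_zero, zero_add]
    refine h.mono ?_ ?_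
    · rintro ⟨x, b⟩ hx
      simp only [Set.mem_ofPred_eq] at hx
      simp only [Set.mem_union, Set.mem_insert_iff, Set.mem_ofPred_eq, Set.mem_singleton_iff,
        Set.mem_empty_iff_false, Prod.mk_add_mk, Prod.mk.injEq]
      rcases zmod_two_cases b with rfl | rfl <;>
        simp (decide := true) only [zero_add, add_zero, not_true, not_false_iff, and_false,
          false_and, or_false, false_or, true_and, and_true, eq_self] at hx ⊢ <;>
        push_cast at hx ⊢ <;> omega
    · rintro ⟨x, b⟩ hx
      simp only [Set.mem_ofPred_eq] at hx
      simp only [Set.mem_union, Set.mem_insert_iff, Set.mem_ofPred_eq, Set.mem_singleton_iff,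
        Set.mem_empty_iff_false, Prod.mk_add_mk, Prod.mk.injEq]
      rcases zmod_two_cases b with rfl | rfl <;>
        simp (decide := true) only [zero_add, add_zero, not_true, not_false_iff, and_false,
          false_and, or_false, false_or, true_and, and_true, eq_self] at hx ⊢ <;>
        push_cast at hx ⊢ <;> omega
  | succ r ih =>
    obtain ⟨e, ih⟩ := ih
    have h := (((ih.reverse.cons (k - d - (r + 1 : ℕ), 1)).snoc (-d - (r + 1 : ℕ), 1)).snoc
      (k - d - (r + 1 : ℕ), 0)).snoc (-d - (r + 1 : ℕ), 0)
    refine ⟨1, h.mono ?_ ?_⟩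
    · rintro ⟨x, b⟩ hx
      simp only [Set.mem_ofPred_eq] at hx
      simp only [Set.mem_union, Set.mem_insert_iff, Set.mem_ofPred_eq, Set.mem_singleton_iff,
        Set.mem_empty_iff_false, Prod.mk_add_mk, Prod.mk.injEq]
      rcases zmod_two_cases b with rfl | rfl <;> rcases zmod_two_cases e with rfl | rfl <;>
        simp (decide := true) only [zero_add, add_zero, not_true, not_false_iff, and_false,
          false_and, or_false, false_or, true_and, and_true, eq_self] at hx ⊢ <;>
        push_cast at hx ⊢ <;> omega
    · rintro ⟨x, b⟩ hx
      simp only [Set.mem_ofPred_eq] at hx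
      simp only [Set.mem_union, Set.mem_insert_iff, Set.mem_ofPred_eq, Set.mem_singleton_iff,
        Set.mem_empty_iff_false, Prod.mk_add_mk, Prod.mk.injEq]
      rcases zmod_two_cases b with rfl | rfl <;> rcases zmod_two_cases e with rfl | rfl <;>
        simp (decide := true) only [zero_add, add_zero, not_true, not_false_iff, and_false,
          false_and, or_false, false_or, true_and, and_true, eq_self] at hx ⊢ <;>
        push_cast at hx ⊢ <;> omega

/-- With offsets `L + 3` and `L + 2` the two turns give all sums at heights `-(2L+1), …, -1` and `2,
…, 2L+1`. The other heights come from the joining terms at `0`, `±1`, `±(2L+4)` and `±(2L+5)`. -/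
theorem harmMod_box_odd (L : ℕ) :
    HarmMod (AddSubgroup.zmultiples ((2 * (2 * L + 5 : ℕ) : ℤ), (0 : ZMod 2))) ⊥
      (2 * (2 * L + 5) * Nat.card (ZMod 2)) := by
  obtain ⟨e, hr⟩ := wpath_turn_right (2 * L + 5) (L + 3) L
  have hl := wpath_turn_left (2 * L + 5) (L + 2) L
  have h1 := (((hr.cons ((-(2 * L + 4) : ℤ), 1)).cons (1, 0)).cons ((-(2 * L + 4) : ℤ), 0)).cons
    ((2 * L + 5 : ℤ), 0)
  have h2 := ((((hl.cons ((2 * L + 4 : ℤ), 0)).cons (0, 1)).cons (0, 0)).cons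
    ((-(2 * L + 5) : ℤ), 1)).cons (1, 1)
  have h := (((h1.append h2).snoc (-1, 1)).snoc ((2 * L + 4 : ℤ), 1)).snoc (-1, 0)
  rcases zmod_two_cases e with rfl | rfl
  · refine WPath.harmMod_box (by omega) (fun b => b = 0) h ?_ ?_ ?_
    · rw [Nat.card_zmod]
      ring
    · rintro x b hx
      simp only [box, Set.mem_ofPred_eq] at hx
      simp only [Set.mem_union, Set.mem_insert_iff, Set.mem_ofPred_eq, Set.mem_singleton_iff,
        Set.mem_empty_iff_false, Prod.mk_add_mk, Prod.mk.injEq]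
      rcases zmod_two_cases b with rfl | rfl <;>
        simp (decide := true) only [zero_add, add_zero, not_true, not_false_iff, and_false, false_and,
          or_false, false_or, true_and, and_true, eq_self] at hx ⊢ <;>
        push_cast at hx ⊢ <;> omega
    · rintro x b hx
      simp only [box, Set.mem_ofPred_eq] at hx
      simp only [Set.mem_union, Set.mem_insert_iff, Set.mem_ofPred_eq, Set.mem_singleton_iff,
        Set.mem_empty_iff_false, Prod.mk_add_mk, Prod.mk.injEq]
      rcases zmod_two_cases b with rfl | rfl <;>
        simp (decide := true) only [zero_add, add_zero, not_true, not_false_iff, and_false, false_and,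
          or_false, false_or, true_and, and_true, eq_self] at hx ⊢ <;>
        push_cast at hx ⊢ <;> omega
  · refine WPath.harmMod_box (by omega) (fun b => b = 0) h ?_ ?_ ?_
    · rw [Nat.card_zmod]
      ring
    · rintro x b hx
      simp only [box, Set.mem_ofPred_eq] at hx
      simp only [Set.mem_union, Set.mem_insert_iff, Set.mem_ofPred_eq, Set.mem_singleton_iff,
        Set.mem_empty_iff_false, Prod.mk_add_mk, Prod.mk.injEq]
      rcases zmod_two_cases b with rfl | rfl <;>
        simp (decide := true) only [zero_add, add_zero, not_true, not_false_iff, and_false, false_and,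
          or_false, false_or, true_and, and_true, eq_self] at hx ⊢ <;>
        push_cast at hx ⊢ <;> omega
    · rintro x b hx
      simp only [box, Set.mem_ofPred_eq] at hx
      simp only [Set.mem_union, Set.mem_insert_iff, Set.mem_ofPred_eq, Set.mem_singleton_iff,
        Set.mem_empty_iff_false, Prod.mk_add_mk, Prod.mk.injEq]
      rcases zmod_two_cases b with rfl | rfl <;>
        simp (decide := true) only [zero_add, add_zero, not_true, not_false_iff, and_false, false_and,
          or_false, false_or, true_and, and_true, eq_self] at hx ⊢ <;>
        push_cast at hx ⊢ <;> omega

theorem harmMod_box_three :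
    HarmMod (AddSubgroup.zmultiples ((2 * (3 : ℕ) : ℤ), (0 : ZMod 2))) ⊥
      (2 * 3 * Nat.card (ZMod 2)) := by
  have h := (((((((((((WPath.single ((0, 0) : ℤ × ZMod 2)).snoc (-2, 0)).snoc (1, 0)).snoc
    (2, 0)).snoc (-3, 1)).snoc (3, 0)).snoc (-2, 1)).snoc (-1, 0)).snoc (-1, 1)).snoc (1, 1)).snoc
    (0, 1)).snoc (2, 1)
  refine WPath.harmMod_box (by omega) (fun b => b = 0) h ?_ ?_ ?_
  · rw [Nat.card_zmod]
  · rintro x b hx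
    simp only [box, Set.mem_ofPred_eq] at hx
    simp only [Set.mem_union, Set.mem_insert_iff, Set.mem_ofPred_eq, Set.mem_singleton_iff,
      Set.mem_empty_iff_false, Prod.mk_add_mk, Prod.mk.injEq]
    rcases zmod_two_cases b with rfl | rfl <;>
      simp (decide := true) only [zero_add, add_zero, not_true, not_false_iff, and_false, false_and,
        or_false, false_or, true_and, and_true, eq_self] at hx ⊢ <;>
      push_cast at hx ⊢ <;> omega
  · rintro x b hx
    simp only [box, Set.mem_ofPred_eq] at hx
    simp only [Set.mem_union, Set.mem_insert_iff, Set.mem_ofPred_eq, Set.mem_singleton_iff,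
      Set.mem_empty_iff_false, Prod.mk_add_mk, Prod.mk.injEq]
    rcases zmod_two_cases b with rfl | rfl <;>
      simp (decide := true) only [zero_add, add_zero, not_true, not_false_iff, and_false, false_and,
        or_false, false_or, true_and, and_true, eq_self] at hx ⊢ <;>
      push_cast at hx ⊢ <;> omega

/-! ### Base cycles for `A` of order four, and for `k = 1` -/

theorem harmMod_box_four_group (n : ℕ) :
    HarmMod (AddSubgroup.zmultiples ((2 * (n + 2 : ℕ) : ℤ), (0 : ZMod 2 × ZMod 2))) ⊥
      (2 * (n + 2) * Nat.card (ZMod 2 × ZMod 2)) := by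
  -- The label sums of the four zigzags are the four different elements of `A`, so each zigzag
  -- provides a long interval of sums for one label.
  have h1 := wpath_zigzag (n + 2) (-1) ((0, 0) : ZMod 2 × ZMod 2) (0, 0) n
  have h2 := wpath_zigzag (n + 1) (-1) ((1, 1) : ZMod 2 × ZMod 2) (1, 0) n
  have h3 := wpath_zigzag (n + 1) (-1) ((1, 0) : ZMod 2 × ZMod 2) (0, 1) n
  have h4 := wpath_zigzag (-1) (n + 1) ((1, 1) : ZMod 2 × ZMod 2) (0, 1) n
  have h := ((((((h1.snoc (-(n + 1), (0, 0))).snoc (1, (0, 0))).snoc (-(n + 1), (0, 1))).append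
    h2.reverse).snoc (0, (0, 1))).append h3).append
    (((((((WPath.single ((-(n + 2), (0, 1)) : ℤ × ZMod 2 × ZMod 2)).snoc (0, (0, 0))).snoc
      (-(n + 2), (1, 1))).snoc (1, (0, 1))).snoc (-(n + 1), (1, 0))).snoc (0, (1, 1))).append
      ((h4.reverse.snoc (n + 2, (1, 0))).snoc (0, (1, 0))))
  refine WPath.harmMod_box (by omega) (fun b => b.2 = 0) h ?_ ?_ ?_
  · rw [Nat.card_prod, Nat.card_zmod]
    ring
  · rintro x b hx
    simp only [box, Set.mem_ofPred_eq] at hx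
    simp only [Set.mem_union, Set.mem_insert_iff, Set.mem_ofPred_eq, Set.mem_singleton_iff,
      Set.mem_empty_iff_false, Prod.mk_add_mk, Prod.mk.injEq]
    rcases b with ⟨b₁, b₂⟩
    rcases zmod_two_cases b₁ with rfl | rfl <;> rcases zmod_two_cases b₂ with rfl | rfl <;>
      simp (decide := true) only [zero_add, add_zero, not_true, not_false_iff, and_false, false_and,
        or_false, false_or, true_and, and_true, eq_self] at hx ⊢ <;>
      push_cast at hx ⊢ <;> omega
  · rintro x b hx
    simp only [box, Set.mem_ofPred_eq] at hx
    simp only [Set.mem_union, Set.mem_insert_iff, Set.mem_ofPred_eq, Set.mem_singleton_iff,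
      Set.mem_empty_iff_false, Prod.mk_add_mk, Prod.mk.injEq]
    rcases b with ⟨b₁, b₂⟩
    rcases zmod_two_cases b₁ with rfl | rfl <;> rcases zmod_two_cases b₂ with rfl | rfl <;>
      simp (decide := true) only [zero_add, add_zero, not_true, not_false_iff, and_false, false_and,
        or_false, false_or, true_and, and_true, eq_self] at hx ⊢ <;>
      push_cast at hx ⊢ <;> omega

theorem zmod_four_cases (b : ZMod 4) : b = 0 ∨ b = 1 ∨ b = 2 ∨ b = 3 := by
  revert b
  decide

theorem harmMod_box_four_odd (i : ℕ) :
    HarmMod (AddSubgroup.zmultiples ((2 * (2 * i + 2 : ℕ) : ℤ), (0 : ZMod 4))) ⊥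
      (2 * (2 * i + 2) * Nat.card (ZMod 4)) := by
  -- The braids `p1`, `p4` and the lowered `p2`, `p3` have complementary label sums, together giving
  -- all four labels at each interior height. Starting `p1` and `p4` at place 1 skips `(k, 1)`,
  -- which closes the cycle instead, and `(k, 3)`, which is outside the box.
  have p1 := wpath_braid (2 * i + 2) (-1) 1 0 0 (2 : ZMod 4) 1 (4 * i + 2)
  have p2 := wpath_braid (2 * i + 1) (-2) 3 1 2 (3 : ZMod 4) 0 (4 * i)
  have p3 := wpath_braid (2 * i + 1) (-2) 1 0 0 (2 : ZMod 4) 0 (4 * i)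
  have p4 := wpath_braid (2 * i + 2) (-1) 3 1 2 (3 : ZMod 4) 1 (4 * i + 2)
  rw [zero_add, braid_zero, braid_at_zero] at p2 p3
  rw [show 1 + (4 * i + 2) = 4 * i + 3 by ring, braid_three, braid_at_one] at p1 p4
  have h := (((((((p1.cons ((2 * i + 2 : ℤ), 0)).cons (0, 0)).snoc (0, 1)).snoc ((-(2 * i + 2) : ℤ), 2)).append
    p2.reverse).snoc (0, 2)).append ((((p3.snoc ((-(2 * i + 2) : ℤ), 3)).snoc (0, 3)).append p4.reverse).snoc
    ((2 * i + 2 : ℤ), 1)))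
  refine WPath.harmMod_box (by omega) (fun b => b = 0 ∨ b = 1) h ?_ ?_ ?_
  · rw [Nat.card_zmod]
    ring
  · rintro x b hx
    simp only [box, Set.mem_ofPred_eq] at hx
    simp only [Set.mem_union, Set.mem_insert_iff, Set.mem_ofPred_eq, Set.mem_singleton_iff,
      Set.mem_empty_iff_false, Prod.mk_add_mk, Prod.mk.injEq]
    rcases zmod_four_cases b with rfl | rfl | rfl | rfl <;>
      simp (decide := true) only [zero_add, add_zero, not_true, not_false_iff, and_false, false_and,
        or_false, false_or, true_and, and_true, eq_self] at hx ⊢ <;>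
      push_cast at hx ⊢ <;> omega

  · rintro x b hx
    simp only [box, Set.mem_ofPred_eq] at hx
    simp only [Set.mem_union, Set.mem_insert_iff, Set.mem_ofPred_eq, Set.mem_singleton_iff,
      Set.mem_empty_iff_false, Prod.mk_add_mk, Prod.mk.injEq]
    rcases zmod_four_cases b with rfl | rfl | rfl | rfl <;>
      simp (decide := true) only [zero_add, add_zero, not_true, not_false_iff, and_false, false_and,
        or_false, false_or, true_and, and_true, eq_self] at hx ⊢ <;>
      push_cast at hx ⊢ <;> omega

theorem harmMod_box_four_even (i : ℕ) :
    HarmMod (AddSubgroup.zmultiples ((2 * (2 * i + 3 : ℕ) : ℤ), (0 : ZMod 4))) ⊥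
      (2 * (2 * i + 3) * Nat.card (ZMod 4)) := by
  -- The same four label patterns as for even `k`; the braids now end at other places of the period,
  -- so the connecting terms change.
  have p1 := wpath_braid (2 * i + 3) (-1) 1 0 0 (2 : ZMod 4) 1 (4 * i + 3)
  have p2 := wpath_braid (2 * i + 2) (-2) 3 1 2 (3 : ZMod 4) 0 (4 * i + 3)
  have p3 := wpath_braid (2 * i + 2) (-2) 1 0 0 (2 : ZMod 4) 0 (4 * i + 3)
  have p4 := wpath_braid (2 * i + 3) (-1) 3 1 2 (3 : ZMod 4) 1 (4 * i + 3)
  rw [zero_add, braid_three, braid_at_zero] at p2 p3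
  rw [show 1 + (4 * i + 3) = 4 * (i + 1) by ring, braid_zero, braid_at_one] at p1 p4
  have h := (((((((p1.cons ((2 * i + 3 : ℤ), 0)).cons (0, 0)).snoc ((-(2 * i + 3) : ℤ), 3)).snoc (0, 3)).append
    p2.reverse).snoc (0, 2)).append ((((p3.snoc (0, 1)).snoc ((-(2 * i + 3) : ℤ), 2)).append p4.reverse).snoc
    ((2 * i + 3 : ℤ), 1)))
  refine WPath.harmMod_box (by omega) (fun b => b = 0 ∨ b = 1) h ?_ ?_ ?_
  · rw [Nat.card_zmod]
    ring
  · rintro x b hx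
    simp only [box, Set.mem_ofPred_eq] at hx
    simp only [Set.mem_union, Set.mem_insert_iff, Set.mem_ofPred_eq, Set.mem_singleton_iff,
      Set.mem_empty_iff_false, Prod.mk_add_mk, Prod.mk.injEq]
    rcases zmod_four_cases b with rfl | rfl | rfl | rfl <;>
      simp (decide := true) only [zero_add, add_zero, not_true, not_false_iff, and_false, false_and,
        or_false, false_or, true_and, and_true, eq_self] at hx ⊢ <;>
      push_cast at hx ⊢ <;> omega

  · rintro x b hx
    simp only [box, Set.mem_ofPred_eq] at hx
    simp only [Set.mem_union, Set.mem_insert_iff, Set.mem_ofPred_eq, Set.mem_singleton_iff,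
      Set.mem_empty_iff_false, Prod.mk_add_mk, Prod.mk.injEq]
    rcases zmod_four_cases b with rfl | rfl | rfl | rfl <;>
      simp (decide := true) only [zero_add, add_zero, not_true, not_false_iff, and_false, false_and,
        or_false, false_or, true_and, and_true, eq_self] at hx ⊢ <;>
      push_cast at hx ⊢ <;> omega

theorem WPath.ofList {G : Type*} [Add G] (u : G) (l : List G) :
    WPath u ((u :: l).getLast (by simp)) {y | y ∈ u :: l} {s | s ∈ List.zipWith (· + ·) (u :: l) l}
      (l.length + 1) := by
  refine ⟨u :: l, rfl, ⟨l, rfl⟩, ⟨(u :: l).dropLast, (List.dropLast_append_getLast _).symm⟩,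
    fun y hy => hy, fun s hs => ?_⟩
  obtain ⟨i, hi, rfl⟩ := List.getElem_of_mem hs
  rw [List.length_zipWith] at hi
  refine ⟨(u :: l)[i]'(by omega), l[i]'(by omega), ⟨(u :: l).take i, l.drop (i + 1), ?_⟩, by simp⟩
  conv_rhs => rw [← List.take_append_drop i (u :: l), List.drop_eq_getElem_cons (by omega),
    List.drop_succ_cons, List.drop_eq_getElem_cons (by omega)]
  simp

/-- For `k = 1` the integer coordinate takes only the values `0, ±1`, leaving no room for braids;
the cycle is explicit, with `B` recording which of `(1, b)` and `(-1, b)` it uses. -/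
theorem harmMod_box_one_four :
    HarmMod (AddSubgroup.zmultiples ((2 * (1 : ℕ) : ℤ), (0 : ZMod 4))) ⊥
      (2 * 1 * Nat.card (ZMod 4)) := by
  have h := WPath.ofList ((0, 0) : ℤ × ZMod 4)
    [(1, 0), (0, 1), (-1, 2), (1, 1), (-1, 3), (0, 3), (0, 2)]
  refine WPath.harmMod_box (by omega) (fun b => b = 0 ∨ b = 1) h ?_ ?_ ?_
  · rw [Nat.card_zmod]
    rfl
  · rintro x b hx
    simp only [box, Set.mem_ofPred_eq] at hx ⊢
    obtain rfl | rfl | rfl : x = 0 ∨ x = 1 ∨ x = -1 := by omega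
    all_goals
      clear h
      revert b
      decide
  · rintro x b hx
    simp only [box, Set.mem_ofPred_eq, Set.mem_insert_iff] at hx ⊢
    obtain rfl | rfl | rfl : x = 0 ∨ x = 1 ∨ x = -1 := by omega
    all_goals
      clear h
      revert b
      decide

theorem harmMod_box_one_eight :
    HarmMod (AddSubgroup.zmultiples ((2 * (1 : ℕ) : ℤ), (0 : ZMod 8))) ⊥
      (2 * 1 * Nat.card (ZMod 8)) := by
  have h := WPath.ofList ((0, 0) : ℤ × ZMod 8)
    [(0, 2), (1, 6), (-1, 3), (0, 4), (-1, 7), (1, 4), (0, 5), (0, 7), (0, 1), (0, 6), (1, 0), (-1, 5), (1, 1), (0, 3), (-1, 2)]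
  refine WPath.harmMod_box (by omega) (fun b => b = 0 ∨ b = 1 ∨ b = 4 ∨ b = 6) h ?_ ?_ ?_
  · rw [Nat.card_zmod]
    rfl
  · rintro x b hx
    simp only [box, Set.mem_ofPred_eq] at hx ⊢
    obtain rfl | rfl | rfl : x = 0 ∨ x = 1 ∨ x = -1 := by omega
    all_goals
      clear h
      revert b
      decide
  · rintro x b hx
    simp only [box, Set.mem_ofPred_eq, Set.mem_insert_iff] at hx ⊢
    obtain rfl | rfl | rfl : x = 0 ∨ x = 1 ∨ x = -1 := by omega
    all_goals
      clear h
      revert b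
      decide

set_option synthInstance.maxSize 1024 in
set_option synthInstance.maxHeartbeats 200000 in
theorem harmMod_box_one_four_two :
    HarmMod (AddSubgroup.zmultiples ((2 * (1 : ℕ) : ℤ), (0 : ZMod 4 × ZMod 2))) ⊥
      (2 * 1 * Nat.card (ZMod 4 × ZMod 2)) := by
  have h := WPath.ofList ((0, (0, 0)) : ℤ × ZMod 4 × ZMod 2)
    [(-1, (1, 0)), (1, (3, 0)), (-1, (0, 1)), (0, (3, 0)), (-1, (1, 1)), (1, (2, 1)), (0, (1, 1)), (0, (1, 0)), (0, (3, 1)), (0, (2, 1)), (0, (0, 1)), (1, (2, 0)), (-1, (3, 1)), (0, (2, 0)), (1, (0, 0))]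
  refine WPath.harmMod_box (by omega) (fun b => b = (0, 0) ∨ b = (3, 0) ∨ b = (2, 1) ∨ b = (2, 0)) h ?_ ?_ ?_
  · rw [Nat.card_prod, Nat.card_zmod, Nat.card_zmod]
    rfl
  · rintro x b hx
    simp only [box, Set.mem_ofPred_eq] at hx ⊢
    obtain rfl | rfl | rfl : x = 0 ∨ x = 1 ∨ x = -1 := by omega
    all_goals
      clear h
      obtain ⟨b₁, b₂⟩ := b
      revert b₁ b₂
      decide
  · rintro x b hx
    simp only [box, Set.mem_ofPred_eq, Set.mem_insert_iff] at hx ⊢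
    obtain rfl | rfl | rfl : x = 0 ∨ x = 1 ∨ x = -1 := by omega
    all_goals
      clear h
      obtain ⟨b₁, b₂⟩ := b
      revert b₁ b₂
      decide

/-! ### Descent through subgroups by weaving -/

theorem index_sup_mul_card {G : Type*} [AddCommGroup G] {H L : AddSubgroup G} (h : H ⊓ L = ⊥) :
    Nat.card L * (H ⊔ L).index = H.index := by
  rw [← AddSubgroup.relIndex_mul_index (le_sup_left : H ≤ H ⊔ L), AddSubgroup.relIndex_sup_left,
    ← AddSubgroup.inf_relIndex_right, h, AddSubgroup.relIndex_bot_left]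

theorem card_mul_relIndex {G : Type*} [AddCommGroup G] {L K : AddSubgroup G} (h : L ≤ K) :
    Nat.card L * L.relIndex K = Nat.card K := by
  rw [← AddSubgroup.relIndex_bot_left L, ← AddSubgroup.relIndex_bot_left K,
    AddSubgroup.relIndex_mul_relIndex _ _ _ bot_le h]

theorem card_map_mk' {G : Type*} [AddCommGroup G] {L K : AddSubgroup G} :
    Nat.card (K.map (QuotientAddGroup.mk' L)) = L.relIndex K := by
  rw [← AddSubgroup.relIndex_ker, QuotientAddGroup.ker_mk']

theorem index_map_mk' {G : Type*} [AddCommGroup G] (L H : AddSubgroup G) :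
    (H.map (QuotientAddGroup.mk' L)).index = (H ⊔ L).index := by
  rw [AddSubgroup.index_map, QuotientAddGroup.ker_mk', QuotientAddGroup.range_mk',
    AddSubgroup.index_top, mul_one]

theorem exists_range_eq_of_isAddCyclic {G : Type*} [AddCommGroup G] {M : AddSubgroup G} {n : ℕ}
    (hM : IsAddCyclic M) (hn : Nat.card M = n) : ∃ θ : ZMod n →+ G, θ.range = M := by
  subst hn
  refine ⟨M.subtype.comp (zmodAddCyclicAddEquiv hM).toAddMonoidHom, ?_⟩
  ext x
  constructor
  · rintro ⟨y, rfl⟩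
    exact Subtype.prop _
  · intro hx
    exact ⟨(zmodAddCyclicAddEquiv hM).symm ⟨x, hx⟩, by simp⟩

theorem exists_range_eq_of_card_four {G : Type*} [AddCommGroup G] {M : AddSubgroup G}
    (hM : Nat.card M = 4) :
    (∃ θ : ZMod 4 →+ G, θ.range = M) ∨ ∃ θ : ZMod 2 × ZMod 2 →+ G, θ.range = M := by
  by_cases hc : IsAddCyclic M
  · exact Or.inl (exists_range_eq_of_isAddCyclic hc hM)
  · right
    have hfin : Finite M := Nat.finite_of_card_ne_zero (by omega)
    have hexp : AddMonoid.exponent M = 2 := by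
      have h1 : AddMonoid.exponent M ∣ 2 ^ 2 := by
        have := AddGroup.exponent_dvd_nat_card (G := M)
        rwa [hM] at this
      obtain ⟨k, hk, e⟩ := (Nat.dvd_prime_pow Nat.prime_two).1 h1
      have h2 : AddMonoid.exponent M ≠ 4 := fun h => hc
        (IsAddCyclic.of_exponent_eq_card (h.trans hM.symm))
      have h3 : AddMonoid.exponent M ≠ 1 := fun h => by
        have := AddMonoid.exp_eq_one_iff.1 h
        have := Nat.card_of_subsingleton (0 : M)
        omega
      interval_cases k <;> simp_all
    have : IsAddKleinFour M := ⟨hM, hexp⟩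
    obtain ⟨e⟩ := IsAddKleinFour.nonempty_addEquiv (G₁ := ZMod 2 × ZMod 2) (G₂ := M)
    refine ⟨M.subtype.comp e.toAddMonoidHom, ?_⟩
    ext x
    constructor
    · rintro ⟨y, rfl⟩
      exact Subtype.prop _
    · intro hx
      exact ⟨e.symm ⟨x, hx⟩, by simp⟩

/-- Either an odd prime divides the order, or the order is a power of 2 and at least 4. -/
theorem exists_addSubgroup_le_card {G : Type*} [AddCommGroup G] [Finite G] {M : AddSubgroup G}
    (h1 : Nat.card M ≠ 1) (h2 : Nat.card M ≠ 2) :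
    ∃ M' ≤ M, Nat.card M' = 4 ∨ (Nat.card M').Prime ∧ Odd (Nat.card M') := by
  have key : ∀ p k : ℕ, p.Prime → p ^ k ∣ Nat.card M → ∃ M' ≤ M, Nat.card M' = p ^ k := by
    intro p k hp hd
    have := Fact.mk hp
    obtain ⟨K, hK⟩ := Sylow.exists_subgroup_card_pow_prime (G := Multiplicative M) p hd
    refine ⟨(Subgroup.toAddSubgroup' K).map M.subtype, ?_, ?_⟩
    · rintro x ⟨y, -, rfl⟩
      exact y.2
    · rw [Nat.card_congr ((Subgroup.toAddSubgroup' K).equivMapOfInjective _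
        M.subtype_injective).toEquiv.symm, ← hK]
      rfl
  by_cases h : ∃ p, p.Prime ∧ p ∣ Nat.card M ∧ p ≠ 2
  · obtain ⟨p, hp, hd, hp2⟩ := h
    obtain ⟨M', hM', hc⟩ := key p 1 hp (by rwa [pow_one])
    rw [pow_one] at hc
    exact ⟨M', hM', Or.inr ⟨hc ▸ hp, hc ▸ hp.odd_of_ne_two hp2⟩⟩
  · push Not at h
    have hpow : Nat.card M = 2 ^ (Nat.card M).primeFactorsList.length :=
      Nat.eq_prime_pow_of_unique_prime_dvd Nat.card_pos.ne' (fun hp hd => h _ hp hd)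
    obtain ⟨M', hM', hc⟩ := key 2 2 Nat.prime_two (by
      rw [hpow]
      apply pow_dvd_pow
      by_contra hlt
      push Not at hlt
      interval_cases (Nat.card M).primeFactorsList.length <;> simp_all)
    exact ⟨M', hM', Or.inl hc⟩

/-- Induction on the index of `L` in `K`. When it exceeds 2, enlarge `L` to `L'` with `L'/L` of
order 4 or of odd prime order; a sequence modulo `L'` is woven through `L'/L` inside `G ⧸ L`. Since
`H` meets `K` trivially, the required length grows by exactly the factor `|L'/L|`. -/
theorem HarmMod.of_relIndex {G : Type*} [AddCommGroup G] [Finite G] {H K : AddSubgroup G}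
    (hHK : H ⊓ K = ⊥) (heven : Even (H ⊔ K).index) (h4 : 4 ≤ (H ⊔ K).index)
    (hbase : ∀ L ≤ K, L.relIndex K = 1 ∨ L.relIndex K = 2 → HarmMod H L (H ⊔ L).index) :
    ∀ L ≤ K, HarmMod H L (H ⊔ L).index := by
  intro L hL
  induction hr : L.relIndex K using Nat.strong_induction_on generalizing L with
  | _ r ih =>
  by_cases hr' : L.relIndex K = 1 ∨ L.relIndex K = 2
  · exact hbase L hL hr'
  push Not at hr'
  have hcM : Nat.card (K.map (QuotientAddGroup.mk' L)) = L.relIndex K := card_map_mk'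
  obtain ⟨M, hM, hc⟩ := exists_addSubgroup_le_card (M := K.map (QuotientAddGroup.mk' L))
    (by rw [hcM]; exact hr'.1) (by rw [hcM]; exact hr'.2)
  set L' := M.comap (QuotientAddGroup.mk' L) with hL'def
  have hLL' : L ≤ L' := by
    intro x hx
    rw [hL'def, AddSubgroup.mem_comap]
    have : QuotientAddGroup.mk' L x = 0 := by simpa using hx
    rw [this]
    exact M.zero_mem
  have hL'K : L' ≤ K := by
    intro x hx
    obtain ⟨y, hy, e⟩ := hM hx
    rw [QuotientAddGroup.mk'_eq_mk'] at e
    obtain ⟨z, hz, rfl⟩ := e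
    exact add_mem hy (hL hz)
  have hmap : L'.map (QuotientAddGroup.mk' L) = M :=
    AddSubgroup.map_comap_eq_self_of_surjective (QuotientAddGroup.mk'_surjective L) M
  have hcard : L.relIndex L' = Nat.card M := by rw [← card_map_mk', hmap]
  have hidx : (H ⊔ L).index = (H ⊔ L').index * Nat.card M := by
    have e1 := index_sup_mul_card (le_bot_iff.1 (hHK ▸ inf_le_inf_left H hL))
    have e2 := index_sup_mul_card (le_bot_iff.1 (hHK ▸ inf_le_inf_left H hL'K))
    rw [← card_mul_relIndex hLL', hcard, ← e1, mul_assoc, mul_comm (Nat.card M)] at e2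
    exact (Nat.eq_of_mul_eq_mul_left Nat.card_pos e2).symm
  have hd : (H ⊔ K).index ∣ (H ⊔ L').index := AddSubgroup.index_dvd_of_le (sup_le_sup_left hL'K H)
  have hpos : (H ⊔ L').index ≠ 0 := AddSubgroup.index_ne_zero_of_finite
  have hne : Even (H ⊔ L').index := heven.trans_dvd hd
  have hge : 4 ≤ (H ⊔ L').index := h4.trans (Nat.le_of_dvd (Nat.pos_of_ne_zero hpos) hd)
  have hlt : L'.relIndex K < r := by
    rw [← hr, ← AddSubgroup.relIndex_mul_relIndex _ _ _ hLL' hL'K, hcard]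
    have : 0 < L'.relIndex K := Nat.pos_of_ne_zero fun h0 => by
      have := card_mul_relIndex hL'K
      rw [h0, mul_zero] at this
      exact Nat.card_pos.ne this
    have : 1 < Nat.card M := by
      rcases hc with hc | hc
      · omega
      · exact hc.1.one_lt
    nlinarith
  have hq := (ih _ hlt L' hL'K rfl).to_quotient L
  rw [hmap] at hq
  have hi := index_map_mk' L H
  rw [hidx] at hi ⊢
  suffices h : HarmMod (H.map (QuotientAddGroup.mk' L)) ⊥ ((H ⊔ L').index * Nat.card M) from
    (h.mono bot_le).of_quotient le_rfl
  rcases hc with hc | ⟨hp, ho⟩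
  · rw [hc] at hi ⊢
    rcases exists_range_eq_of_card_four hc with ⟨θ, hθ⟩ | ⟨θ, hθ⟩
    · exact HarmMod.weave_four θ hne hpos hi (by rwa [hθ])
    · exact HarmMod.weave_four_group θ hne hge hi (by rwa [hθ])
  · have := Fact.mk hp
    obtain ⟨θ, hθ⟩ := exists_range_eq_of_isAddCyclic (M := M)
      (isAddCyclic_of_prime_card rfl) rfl
    exact HarmMod.weave_odd ho θ hpos hi (by rwa [hθ])

/-! ### Transporting the base cycles along a character -/

theorem exists_zmod_hom {Q : Type*} [AddCommGroup Q] {n : ℕ} {y : Q} (hy : n • y = 0) :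
    ∃ ψ : ZMod n →+ Q, ∀ j : ℤ, ψ j = j • y :=
  ⟨ZMod.lift n ⟨zmultiplesHom Q y, by simpa using hy⟩, fun j => by simp⟩

/-- The map `(i, a) ↦ i g + ψ a` into `G ⧸ L` sends `(2k, 0)` into the image of `H` and meets every
coset. -/
theorem HarmMod.of_box {G A : Type*} [AddCommGroup G] [AddCommGroup A] {H D L : AddSubgroup G}
    {k n : ℕ} {g : G}
    (hbox : HarmMod (AddSubgroup.zmultiples ((2 * k : ℤ), (0 : A))) ⊥ n)
    (hg : (2 * k) • g ∈ H) (hcov : ∀ q, ∃ i : ℤ, ∃ d ∈ D, q - i • g - d ∈ H)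
    (ψ : A →+ G ⧸ L) (hψ : ∀ d ∈ D, ∃ a, ψ a = d) : HarmMod H L n := by
  suffices h : HarmMod (H.map (QuotientAddGroup.mk' L)) ⊥ n from (h.mono bot_le).of_quotient le_rfl
  refine hbox.map ((zmultiplesHom (G ⧸ L) (g : G ⧸ L)).coprod ψ) ?_ ?_ ?_
  · rintro x ⟨z, rfl⟩
    refine ⟨z • (2 * k) • g, zsmul_mem hg z, ?_⟩
    simp [mul_smul, ← natCast_zsmul]

  · rintro x hx
    rw [AddSubgroup.mem_bot] at hx ⊢
    rw [hx, map_zero]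
  · intro q
    obtain ⟨q, rfl⟩ := QuotientAddGroup.mk_surjective q
    obtain ⟨i, d, hd, hq⟩ := hcov q
    obtain ⟨a, ha⟩ := hψ d hd
    refine ⟨(i, a), ?_⟩
    rw [sup_bot_eq]
    refine ⟨-(q - i • g - d), neg_mem hq, ?_⟩
    simp [ha]
    abel

/-- The three base cases of the induction, for a character of `D` onto `ZMod s`. -/
theorem HarmMod.of_character {G : Type*} [AddCommGroup G] [Finite G] {H D : AddSubgroup G}
    {k s t : ℕ} [NeZero s] (ht : t = 2 * s) (hks : 4 ≤ 2 * k * s)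
    (h₁ : HarmMod (AddSubgroup.zmultiples ((2 * k : ℤ), (0 : ZMod s))) ⊥
      (2 * k * Nat.card (ZMod s)))
    (h₂ : HarmMod (AddSubgroup.zmultiples ((2 * k : ℤ), (0 : ZMod t))) ⊥
      (2 * k * Nat.card (ZMod t)))
    (h₃ : HarmMod (AddSubgroup.zmultiples ((2 * k : ℤ), (0 : ZMod s × ZMod 2))) ⊥
      (2 * k * Nat.card (ZMod s × ZMod 2)))
    {g : G} (hg : (2 * k) • g ∈ H) (hHD : H ⊓ D = ⊥)
    (hcov : ∀ q, ∃ i : ℤ, ∃ d ∈ D, q - i • g - d ∈ H)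
    (hcard : 2 * k * Nat.card D * Nat.card H = Nat.card G)
    (χ : G →+ ZMod s) {x : G} (hxD : x ∈ D) (hx : χ x = 1) : HarmMod H ⊥ H.index := by
  subst ht
  have hHidx : H.index = 2 * k * Nat.card D :=
    Nat.eq_of_mul_eq_mul_left (Nat.card_pos (α := H)) (by
      rw [AddSubgroup.card_mul_index, ← hcard, mul_comm])
  set K := D ⊓ χ.ker with hK
  have hHK : H ⊓ K = ⊥ := le_bot_iff.1 (hHD ▸ inf_le_inf_left H inf_le_left)
  have hχ : ∀ c : ZMod s, ∃ j : ℤ, χ (j • x) = c := fun c => by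
    obtain ⟨j, rfl⟩ := ZMod.intCast_surjective c
    exact ⟨j, by rw [map_zsmul, hx]; simp⟩
  have hred : ∀ d ∈ D, ∃ j : ℤ, d - j • x ∈ K := fun d hd => by
    obtain ⟨j, hj⟩ := hχ (χ d)
    exact ⟨j, AddSubgroup.mem_inf.2 ⟨sub_mem hd (zsmul_mem hxD j), AddMonoidHom.mem_ker.2 (by
      rw [map_sub, hj, sub_self])⟩⟩
  have hsx : s • x ∈ K := ⟨nsmul_mem hxD s, by simp [hx]⟩
  have hKD : K.relIndex D = s := by
    rw [hK, AddSubgroup.inf_relIndex_left, AddSubgroup.relIndex_ker,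
      show D.map χ = ⊤ from eq_top_iff.2 fun c _ => ?_]
    · simp
    · obtain ⟨j, hj⟩ := hχ c
      exact ⟨j • x, zsmul_mem hxD j, hj⟩
  have hidx : ∀ L ≤ K, (H ⊔ L).index = 2 * k * (s * L.relIndex K) := by
    intro L hL
    have e := index_sup_mul_card (le_bot_iff.1 (hHK ▸ inf_le_inf_left H hL))
    rw [hHidx, ← card_mul_relIndex (inf_le_left : K ≤ D), ← card_mul_relIndex hL, hKD] at e
    refine Nat.eq_of_mul_eq_mul_left (Nat.card_pos (α := L)) (e.trans ?_)
    ring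
  have hKidx := hidx K le_rfl
  rw [AddSubgroup.relIndex_self, mul_one] at hKidx
  have := HarmMod.of_relIndex hHK (by rw [hKidx, mul_assoc]; exact even_two_mul _)
    (by rwa [hKidx]) ?_ ⊥ bot_le
  · rwa [sup_bot_eq] at this
  intro L hL hLK
  have hq0 : ∀ y : G, (y : G ⧸ L) = 0 ↔ y ∈ L := fun y => QuotientAddGroup.eq_zero_iff y
  rcases hLK with hLK | hLK
  · rw [hidx L hL, hLK, mul_one, ← Nat.card_zmod s]
    obtain rfl : L = K := le_antisymm hL (AddSubgroup.relIndex_eq_one.1 hLK)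
    obtain ⟨ψ, hψ⟩ := exists_zmod_hom (n := s) (y := (x : G ⧸ K)) ((hq0 _).2 hsx)
    refine h₁.of_box hg hcov ψ fun d hd => ?_
    obtain ⟨j, hj⟩ := hred d hd
    refine ⟨j, ?_⟩
    rw [hψ, eq_comm, ← sub_eq_zero]
    exact (hq0 _).2 hj
  · obtain ⟨w, hwK, hwL⟩ : ∃ w ∈ K, w ∉ L := by
      by_contra! h
      rw [AddSubgroup.relIndex_eq_one.2 h] at hLK
      omega
    have hsub : ∀ y ∈ K, ∀ y' ∈ K, y ∉ L → y' ∉ L → y - y' ∈ L := by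
      intro y hy y' hy' hyL hyL'
      have := AddSubgroup.add_mem_iff_of_index_two (H := L.addSubgroupOf K) hLK (a := ⟨y, hy⟩)
        (b := -⟨y', hy'⟩)
      simp only [neg_mem_iff, AddSubgroup.mem_addSubgroupOf, hyL, hyL', iff_true] at this
      rw [sub_eq_add_neg]
      exact this
    have hdbl : ∀ y ∈ K, (2 : ℕ) • y ∈ L := by
      intro y hy
      by_cases hyL : y ∈ L
      · exact nsmul_mem hyL 2
      · have := hsub y hy (-y) (neg_mem hy) hyL (by rwa [neg_mem_iff])
        rwa [sub_neg_eq_add, ← two_nsmul] at this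
    -- Now `D/L` has order `2s`. If `s x ∈ L` it is split, generated by `x` and an extra involution
    -- `w`; otherwise it is cyclic, generated by `x`.
    by_cases hsL : s • x ∈ L
    · rw [hidx L hL, hLK, ← show Nat.card (ZMod s × ZMod 2) = s * 2 by
        rw [Nat.card_prod, Nat.card_zmod, Nat.card_zmod]]
      obtain ⟨ψ, hψ⟩ := exists_zmod_hom (n := s) (y := (x : G ⧸ L)) ((hq0 _).2 hsL)
      obtain ⟨ψ', hψ'⟩ := exists_zmod_hom (n := 2) (y := (w : G ⧸ L)) ((hq0 _).2 (hdbl w hwK))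
      refine h₃.of_box hg hcov (ψ.coprod ψ') fun d hd => ?_
      obtain ⟨j, hj⟩ := hred d hd
      by_cases hjL : d - j • x ∈ L
      · refine ⟨(j, (0 : ℤ)), ?_⟩
        rw [AddMonoidHom.coprod_apply, hψ, hψ', eq_comm, zero_smul, add_zero, ← sub_eq_zero]
        exact (hq0 _).2 hjL
      · refine ⟨(j, (1 : ℤ)), ?_⟩
        rw [AddMonoidHom.coprod_apply, hψ, hψ', eq_comm, one_smul, ← sub_eq_zero, ← sub_sub]
        exact (hq0 _).2 (hsub _ hj w hwK hjL hwL)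
    · rw [hidx L hL, hLK, mul_comm s, ← Nat.card_zmod (2 * s)]
      obtain ⟨ψ, hψ⟩ := exists_zmod_hom (n := 2 * s) (y := (x : G ⧸ L)) ((hq0 _).2 (by
        have := hdbl _ hsx
        rwa [← mul_smul] at this))
      refine h₂.of_box hg hcov ψ fun d hd => ?_
      obtain ⟨j, hj⟩ := hred d hd
      by_cases hjL : d - j • x ∈ L
      · refine ⟨j, ?_⟩
        rw [hψ, eq_comm, ← sub_eq_zero]
        exact (hq0 _).2 hjL
      -- Both `d - j x` and `s x` lie in the nontrivial coset of `L` in `K`, so they agree modulo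
      -- `L`.
      · refine ⟨(j + s : ℤ), ?_⟩
        rw [hψ, eq_comm, add_smul, ← sub_eq_zero, ← sub_sub, natCast_zsmul]
        exact (hq0 _).2 (hsub _ hj _ hsx hjL hsL)

theorem harmMod_box_two {k : ℕ} (hk : 2 ≤ k) :
    HarmMod (AddSubgroup.zmultiples ((2 * k : ℤ), (0 : ZMod 2))) ⊥
      (2 * k * Nat.card (ZMod 2)) := by
  rcases Nat.even_or_odd' k with ⟨j, rfl | rfl⟩
  · obtain ⟨i, rfl⟩ : ∃ i, j = i + 1 := ⟨j - 1, by omega⟩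
    exact harmMod_box_even i
  · obtain rfl | ⟨i, rfl⟩ : j = 1 ∨ ∃ i, j = i + 2 := by
      rcases (show 1 ≤ j by omega).eq_or_lt with h | h
      · exact Or.inl h.symm
      · exact Or.inr ⟨j - 2, by omega⟩
    · exact harmMod_box_three
    · exact harmMod_box_odd i

theorem harmMod_box_zmod_four {k : ℕ} (hk : 2 ≤ k) :
    HarmMod (AddSubgroup.zmultiples ((2 * k : ℤ), (0 : ZMod 4))) ⊥
      (2 * k * Nat.card (ZMod 4)) := by
  rcases Nat.even_or_odd' k with ⟨j, rfl | rfl⟩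
  · obtain ⟨i, rfl⟩ : ∃ i, j = i + 1 := ⟨j - 1, by omega⟩
    exact harmMod_box_four_odd i
  · obtain ⟨i, rfl⟩ : ∃ i, j = i + 1 := ⟨j - 1, by omega⟩
    exact harmMod_box_four_even i

theorem harmMod_box_two_two {k : ℕ} (hk : 2 ≤ k) :
    HarmMod (AddSubgroup.zmultiples ((2 * k : ℤ), (0 : ZMod 2 × ZMod 2))) ⊥
      (2 * k * Nat.card (ZMod 2 × ZMod 2)) := by
  obtain ⟨i, rfl⟩ : ∃ i, k = i + 2 := ⟨k - 2, by omega⟩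
  exact harmMod_box_four_group i

/-! ### Choosing the data in a direct sum of cyclic groups -/

theorem IsHarmonious.of_addEquiv {V Γ Γ' : Type*} [AddCommGroup Γ] [AddCommGroup Γ']
    {G : SimpleGraph V} (e : Γ ≃+ Γ') (h : IsHarmonious G Γ) : IsHarmonious G Γ' := by
  obtain ⟨f, hf, hb⟩ := h
  refine ⟨e ∘ f, e.injective.comp hf, ?_⟩
  have : (fun x : G.edgeSet => inducedLabel (e ∘ f) (x : Sym2 V)) =
      e ∘ fun x : G.edgeSet => inducedLabel f (x : Sym2 V) := by
    funext ⟨x, hx⟩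
    induction x using Sym2.ind with
    | _ x y => exact (map_add e (f x) (f y)).symm
  rw [this]
  exact e.bijective.comp hb

/-- Harmonious labelings of a closed web by a direct sum of cyclic groups, given a character of a
complement. -/
theorem closedWeb_isHarmonious_of_pi {ι : Type*} [Fintype ι] [DecidableEq ι] (ν : ι → ℕ)
    (hν : ∀ i, 0 < ν i) {i₀ i₁ : ι} (hi : i₀ ≠ i₁) {m n r u v k : ℕ} (hm : 1 ≤ m) (hn : 3 ≤ n)
    (hcard : Nat.card ((i : ι) → ZMod (ν i)) = 2 * m * n) (h₀ : ν i₀ = 2 * m * r)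
    (h₁ : ν i₁ = u * v) (huv : u.Coprime v) (hrv : r.Coprime v) (hk : r * v = 2 * k)
    (hχ : (2 ≤ k ∧ ∃ χ : ((i : ι) → ZMod (ν i)) →+ ZMod 2, ∃ x, x i₀ = 0 ∧
        ((x i₁).cast : ZMod v) = 0 ∧ χ x = 1) ∨
      (k = 1 ∧ ∃ χ : ((i : ι) → ZMod (ν i)) →+ ZMod 4, ∃ x, x i₀ = 0 ∧
        ((x i₁).cast : ZMod v) = 0 ∧ χ x = 1)) :
    IsHarmonious (closedWeb m n) ((i : ι) → ZMod (ν i)) := by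
  have : ∀ i, NeZero (ν i) := fun i => ⟨(hν i).ne'⟩
  have hr : 0 < r := Nat.pos_of_ne_zero fun h => by
    have := hν i₀
    rw [h₀, h, mul_zero] at this
    omega
  have hvν : v ∣ ν i₁ := h₁ ▸ dvd_mul_left v u
  set h : (i : ι) → ZMod (ν i) := Pi.single i₀ (r : ZMod (ν i₀)) with hh
  have hord : addOrderOf h = 2 * m := by
    have e := addOrderOf_injective (AddMonoidHom.single (fun i => ZMod (ν i)) i₀)
      (fun x y hxy => Pi.single_injective (M := fun i => ZMod (ν i)) i₀ hxy) (r : ZMod (ν i₀))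
    have e' := ZMod.addOrderOf_coe r (hν i₀).ne'
    rw [congrArg₂ (· / ·) h₀ (congrArg (fun x => Nat.gcd x r) h₀)] at e'
    rw [Nat.gcd_eq_right (dvd_mul_left r _), Nat.mul_div_cancel _ hr] at e'
    exact e.trans e'
  set H := AddSubgroup.zmultiples h with hH
  have hHcard : Nat.card H = 2 * m := by rw [hH, Nat.card_zmultiples, hord]
  have hHidx : H.index = n := by
    have e := AddSubgroup.card_mul_index H
    rw [hcard, hHcard] at e
    exact Nat.eq_of_mul_eq_mul_left (by omega) e
  have hHmem : ∀ x : (i : ι) → ZMod (ν i), (∃ z : ℤ, x i₀ = z * r) → (∀ j ≠ i₀, x j = 0) →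
      x ∈ H := by
    rintro x ⟨z, hz⟩ hx
    refine ⟨z, ?_⟩
    funext j
    by_cases hj : j = i₀
    · subst hj
      simp [hh, hz]
    · simp [hh, hx j hj, Pi.single_eq_of_ne hj]
  -- The kernel `D` complements `⟨g⟩` modulo `H`: it keeps the `u`-part of the `i₁` coordinate and
  -- all coordinates other than `i₀` and `i₁`.
  let φ : ((i : ι) → ZMod (ν i)) →+ ZMod (ν i₀) × ZMod v :=
    (Pi.evalAddMonoidHom (fun i => ZMod (ν i)) i₀).prod
      ((ZMod.castHom hvν (ZMod v)).toAddMonoidHom.comp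
        (Pi.evalAddMonoidHom (fun i => ZMod (ν i)) i₁))
  have hφ : ∀ x, φ x = (x i₀, ((x i₁).cast : ZMod v)) := fun x => rfl
  have hφsurj : Function.Surjective φ := by
    rintro ⟨a, b⟩
    obtain ⟨b, rfl⟩ := ZMod.intCast_surjective b
    refine ⟨Pi.single i₀ a + Pi.single i₁ (b : ZMod (ν i₁)), ?_⟩
    rw [hφ]
    simp [hi, hi.symm, ZMod.cast_intCast hvν]
  set D := φ.ker with hD
  have hDmem : ∀ x, x ∈ D ↔ x i₀ = 0 ∧ ((x i₁).cast : ZMod v) = 0 := fun x => by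
    rw [hD, AddMonoidHom.mem_ker, hφ, Prod.mk_eq_zero]
  have hDcard : 2 * k * Nat.card D * Nat.card H = Nat.card ((i : ι) → ZMod (ν i)) := by
    rw [← AddSubgroup.card_mul_index D, hD, AddSubgroup.index_ker,
      AddMonoidHom.range_eq_top.2 hφsurj, ← hD, hHcard, AddSubgroup.card_top, Nat.card_prod,
      Nat.card_zmod, Nat.card_zmod, h₀, ← hk]
    ring
  -- Modulo `H` this has a component of order `r` at `i₀` and one of order `v` at `i₁`; as `r` and
  -- `v` are coprime, the order is `r v = 2k`.
  let g : (i : ι) → ZMod (ν i) := Pi.single i₀ 1 + Pi.single i₁ (u : ZMod (ν i₁))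
  have hg : (2 * k) • g ∈ H := by
    refine hHmem _ ⟨v, ?_⟩ fun j hj => ?_
    · simp [g, hi, ← Nat.cast_mul, ← hk, mul_comm]
    · by_cases hj' : j = i₁
      · subst hj'
        have : ((2 * k) • g) j = ((2 * k * u : ℕ) : ZMod (ν j)) := by
          simp [g, hj]
        rw [this, ZMod.natCast_eq_zero_iff, h₁, ← hk, mul_assoc, mul_comm u]
        exact dvd_mul_left _ _
      · simp [g, hj, hj']
  have hHD : H ⊓ D = ⊥ := by
    rw [eq_bot_iff]
    rintro x ⟨⟨z, rfl⟩, hxD⟩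
    have h1 := ((hDmem _).1 hxD).1
    rw [AddSubgroup.mem_bot]
    funext j
    by_cases hj : j = i₀
    · subst hj
      exact h1
    · simp [hh, Pi.single_eq_of_ne hj]
  have hcov : ∀ q, ∃ i : ℤ, ∃ d ∈ D, q - i • g - d ∈ H := by
    intro q
    obtain ⟨a, ha⟩ := ZMod.intCast_surjective (q i₀)
    obtain ⟨b, hb⟩ := ZMod.intCast_surjective (q i₁)
    have hu : IsCoprime (u : ℤ) v := Nat.isCoprime_iff_coprime.2 huv
    have hr' : IsCoprime (r : ℤ) v := Nat.isCoprime_iff_coprime.2 hrv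
    obtain ⟨c, c', hc⟩ := hu
    obtain ⟨s, s', hs⟩ := hr'
    -- an integer congruent to `a` modulo `r` and to `b / u` modulo `v`
    obtain ⟨i, hia, hib⟩ : ∃ i : ℤ, (∃ z, a - i = z * r) ∧ (v : ℤ) ∣ b - i * u :=
      ⟨a * s' * v + b * c * s * r, ⟨a * s - b * c * s, by linear_combination (-a) * hs⟩, by
        refine ⟨b * c' + b * c * s' * u - a * s' * u, ?_⟩
        linear_combination (-b) * hc - b * c * u * hs⟩
    refine ⟨i, Function.update (q - i • g) i₀ 0, (hDmem _).2 ⟨by simp, ?_⟩, ?_⟩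
    · have : (q - i • g) i₁ = ((b - i * u : ℤ) : ZMod (ν i₁)) := by
        simp [g, hi.symm, ← hb]
      rw [Function.update_of_ne hi.symm, this, ZMod.cast_intCast hvν,
        ZMod.intCast_zmod_eq_zero_iff_dvd]
      exact hib
    · obtain ⟨z, hz⟩ := hia
      refine hHmem _ ⟨z, ?_⟩ fun j hj => by simp [hj]
      have : (q - i • g - Function.update (q - i • g) i₀ 0) i₀ = ((a - i : ℤ) : ZMod (ν i₀)) := by
        simp [g, hi, ← ha]
      rw [this, hz]
      simp
  refine closedWeb_isHarmonious_of_harmMod hm hn hcard h hord ?_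
  rw [← hH, ← hHidx]
  rcases hχ with ⟨hk2, χ, x, hx0, hx1, hx⟩ | ⟨rfl, χ, x, hx0, hx1, hx⟩
  · exact HarmMod.of_character (t := 4) rfl (by omega) (harmMod_box_two hk2)
      (harmMod_box_zmod_four hk2) (harmMod_box_two_two hk2) hg hHD hcov hDcard χ
      ((hDmem x).2 ⟨hx0, hx1⟩) hx
  · exact HarmMod.of_character (t := 8) rfl (by omega) harmMod_box_one_four
      harmMod_box_one_eight harmMod_box_one_four_two hg hHD hcov hDcard χ
      ((hDmem x).2 ⟨hx0, hx1⟩) hx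

/-- The coordinate `i₀` alone gives `k = r`, with the character read off `i₁`. For `r = 1` this
needs a character onto `ℤ/4`; if `4 ∤ ν i₁`, then `ν i₁ = 2p` with `p ≥ 3` odd, and moving the
`p`-part into `g` gives `k = p`. -/
theorem closedWeb_isHarmonious_of_even {ι : Type*} [Fintype ι] [DecidableEq ι] (ν : ι → ℕ)
    (hν : ∀ i, 0 < ν i) {i₀ i₁ : ι} (hi : i₀ ≠ i₁) {m n r : ℕ} (hm : 1 ≤ m) (hn : 3 ≤ n)
    (hcard : Nat.card ((i : ι) → ZMod (ν i)) = 2 * m * n) (h₀ : ν i₀ = 2 * m * (2 * r))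
    (h₁ : 2 ∣ ν i₁) (h : 2 ≤ r ∨ 4 ≤ ν i₁) :
    IsHarmonious (closedWeb m n) ((i : ι) → ZMod (ν i)) := by
  have hr : 0 < r := Nat.pos_of_ne_zero fun h => by
    have := hν i₀
    rw [h₀, h] at this
    omega
  have hχ : ∀ s : ℕ, s ∣ ν i₁ → ∃ χ : ((i : ι) → ZMod (ν i)) →+ ZMod s,
      ∀ j : ℕ, χ (Pi.single i₁ (j : ZMod (ν i₁))) = j := fun s hs =>
    ⟨(ZMod.castHom hs (ZMod s)).toAddMonoidHom.comp (Pi.evalAddMonoidHom (fun i => ZMod (ν i)) i₁),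
      fun j => by simp⟩
  by_cases hr2 : 2 ≤ r
  · obtain ⟨χ, hχ⟩ := hχ 2 h₁
    refine closedWeb_isHarmonious_of_pi ν hν hi hm hn hcard h₀ (u := ν i₁) (v := 1) (k := r)
      (mul_one _).symm (Nat.coprime_one_right _) (Nat.coprime_one_right _) (mul_one _)
      (Or.inl ⟨hr2, χ, Pi.single i₁ (1 : ℕ), by simp [hi], Subsingleton.elim _ _, ?_⟩)
    rw [hχ, Nat.cast_one]
  · have hr1 : r = 1 := by omega
    subst hr1
    by_cases h4 : 4 ∣ ν i₁
    · obtain ⟨χ, hχ⟩ := hχ 4 h4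
      refine closedWeb_isHarmonious_of_pi ν hν hi hm hn hcard h₀ (u := ν i₁) (v := 1) (k := 1)
        (mul_one _).symm (Nat.coprime_one_right _) (Nat.coprime_one_right _) (mul_one _)
        (Or.inr ⟨rfl, χ, Pi.single i₁ (1 : ℕ), by simp [hi], Subsingleton.elim _ _, ?_⟩)
      rw [hχ, Nat.cast_one]
    · obtain ⟨χ, hχ⟩ := hχ 2 h₁
      obtain ⟨p, hp⟩ := h₁
      have hodd : p % 2 = 1 := by omega
      have hcop : Nat.Coprime 2 p := (Nat.coprime_two_left).2 (Nat.odd_iff.2 hodd)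
      refine closedWeb_isHarmonious_of_pi ν hν hi hm hn hcard h₀ (u := 2) (v := p) (k := p)
        hp hcop hcop rfl
        (Or.inl ⟨by omega, χ, Pi.single i₁ (p : ℕ), by simp [hi], ?_, ?_⟩)
      · rw [Pi.single_eq_same, ZMod.cast_natCast (hp ▸ dvd_mul_left p 2), ZMod.natCast_self]
      · rw [hχ, ← ZMod.natCast_mod, hodd, Nat.cast_one]

/-- Since `r` is odd, `g` must take its even order from `i₁`: all of `ν i₁` if `r = 1`, only its
2-part otherwise, to keep the orders coprime. The character is then left to `i₂`. -/
theorem closedWeb_isHarmonious_of_odd {ι : Type*} [Fintype ι] [DecidableEq ι] (ν : ι → ℕ)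
    (hν : ∀ i, 0 < ν i) {i₀ i₁ i₂ : ι} (hi : i₀ ≠ i₁) (hi₀ : i₂ ≠ i₀) (hi₁ : i₂ ≠ i₁)
    {m n r : ℕ} (hm : 1 ≤ m) (hn : 3 ≤ n)
    (hcard : Nat.card ((i : ι) → ZMod (ν i)) = 2 * m * n) (h₀ : ν i₀ = 2 * m * r) (hr : Odd r)
    (h₁ : 2 ∣ ν i₁) (h₄ : 4 ≤ ν i₁) (h₂ : 2 ∣ ν i₂) :
    IsHarmonious (closedWeb m n) ((i : ι) → ZMod (ν i)) := by
  have hχ : ∃ χ : ((i : ι) → ZMod (ν i)) →+ ZMod 2, χ (Pi.single i₂ 1) = 1 :=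
    ⟨(ZMod.castHom h₂ (ZMod 2)).toAddMonoidHom.comp (Pi.evalAddMonoidHom (fun i => ZMod (ν i)) i₂),
      by simp [ZMod.cast_one h₂]⟩
  obtain ⟨χ, hχ⟩ := hχ
  by_cases hr1 : r = 1
  · subst hr1
    obtain ⟨k, hk⟩ := h₁
    exact closedWeb_isHarmonious_of_pi ν hν hi hm hn hcard h₀ (u := 1) (v := ν i₁) (k := k)
      (one_mul _).symm (Nat.coprime_one_left _) (Nat.coprime_one_left _) (by rw [one_mul, hk])
      (Or.inl ⟨by omega, χ, Pi.single i₂ 1, by simp [hi₀.symm], by simp [hi₁.symm], hχ⟩)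
  · obtain ⟨c, o, ho, hc⟩ := Nat.exists_eq_two_pow_mul_odd (hν i₁).ne'
    obtain ⟨c, rfl⟩ : ∃ d, c = d + 1 := Nat.exists_eq_succ_of_ne_zero fun h => by
      rw [h, pow_zero, one_mul] at hc
      rw [hc] at h₁
      exact (Nat.not_even_iff_odd.2 ho) (even_iff_two_dvd.2 h₁)
    have hpos : 0 < 2 ^ c := by positivity
    refine closedWeb_isHarmonious_of_pi ν hν hi hm hn hcard h₀ (u := o) (v := 2 ^ (c + 1))
      (k := r * 2 ^ c) (by rw [hc, mul_comm])
      (Nat.Coprime.pow_right _ (Nat.coprime_two_right.2 ho))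
      (Nat.Coprime.pow_right _ (Nat.coprime_two_right.2 hr)) (by ring)
      (Or.inl ⟨?_, χ, Pi.single i₂ 1, by simp [hi₀.symm], by simp [hi₁.symm], hχ⟩)
    have : 2 ≤ r := by
      obtain ⟨j, rfl⟩ := hr
      omega
    nlinarith

/-! ### The four cases of the corollary -/

theorem mainTheorem10 (m n : ℕ) (hm : 2 ≤ m) (hn : 4 ≤ n) (hn_even : Even n)
    (Γ : Type*) [AddCommGroup Γ] (hΓ : Nat.card Γ = 2 * m * n)
    (t : ℕ) (ht : 2 ≤ t) (ν : Fin t → ℕ) (hν : IsNestedForm Γ ν)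
    (hK : ∃ K : AddSubgroup Γ, IsAddCyclic K ∧ Nat.card K = 2 * m)
    (hcases :
      (ν ⟨0, Nat.zero_lt_of_lt ht⟩ ≡ 0 [MOD 8 * m] ∧ ν ⟨1, ht⟩ ≡ 0 [MOD 2]) ∨
      (ν ⟨0, Nat.zero_lt_of_lt ht⟩ ≡ 0 [MOD 4 * m] ∧ ν ⟨1, ht⟩ ≡ 0 [MOD 2] ∧ 4 ≤ ν ⟨1, ht⟩) ∨
      (∃ ht3 : 3 ≤ t, ν ⟨0, Nat.zero_lt_of_lt ht⟩ ≡ 0 [MOD 2 * m] ∧ ν ⟨1, ht⟩ ≡ 0 [MOD 4] ∧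
        ν ⟨2, ht3⟩ ≡ 0 [MOD 2]) ∨
      (∃ ht3 : 3 ≤ t, ν ⟨0, Nat.zero_lt_of_lt ht⟩ ≡ 0 [MOD 2 * m] ∧ ν ⟨2, ht3⟩ ≡ 0 [MOD 2] ∧
        1 < ν ⟨t - 1, Nat.sub_one_lt_of_lt ht⟩ ∧ Odd (ν ⟨t - 1, Nat.sub_one_lt_of_lt ht⟩))) :
    IsHarmonious (closedWeb m n) Γ := by
  obtain ⟨h2, hdvd, ⟨e⟩⟩ := hν
  have hchain : ∀ (j : ℕ) (hj : j < t) (i : ℕ) (hi : i ≤ j), ν ⟨j, hj⟩ ∣ ν ⟨i, hi.trans_lt hj⟩ := by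
    intro j
    induction j with
    | zero =>
      intro hj i hi
      obtain rfl : i = 0 := by omega
      exact dvd_rfl
    | succ j ih =>
      intro hj i hi
      rcases hi.eq_or_lt with rfl | hi
      · exact dvd_rfl
      · exact (hdvd ⟨j, by omega⟩ ⟨j + 1, hj⟩ rfl).trans (ih (by omega) i (by omega))
  refine IsHarmonious.of_addEquiv e.symm ?_
  have hcard : Nat.card ((i : Fin t) → ZMod (ν i)) = 2 * m * n := by
    rw [← hΓ, Nat.card_congr e.toEquiv]
  have hpos : ∀ i, 0 < ν i := fun i => by
    have := h2 i
    omega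
  have h01 : (⟨0, Nat.zero_lt_of_lt ht⟩ : Fin t) ≠ ⟨1, ht⟩ := by simp
  simp only [Nat.modEq_zero_iff_dvd] at hcases
  -- The last two conditions both give this: an even third factor and a second factor at least 4.
  -- The parity of `n₁ / 2m` decides which construction applies.
  have key : ∀ ht3 : 3 ≤ t, 2 * m ∣ ν ⟨0, Nat.zero_lt_of_lt ht⟩ → 4 ≤ ν ⟨1, ht⟩ →
      2 ∣ ν ⟨2, ht3⟩ → IsHarmonious (closedWeb m n) ((i : Fin t) → ZMod (ν i)) := by
    rintro ht3 ⟨r, hr⟩ h4 h3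
    have h1 : 2 ∣ ν ⟨1, ht⟩ := h3.trans (hchain 2 ht3 1 (by omega))
    rcases Nat.even_or_odd r with hr2 | hr2
    · obtain ⟨s, rfl⟩ := even_iff_exists_two_mul.1 hr2
      exact closedWeb_isHarmonious_of_even ν hpos h01 (by omega) (by omega) hcard hr h1 (Or.inr h4)
    · exact closedWeb_isHarmonious_of_odd ν hpos h01 (i₂ := ⟨2, ht3⟩) (by simp) (by simp)
        (by omega) (by omega) hcard hr hr2 h1 h4 h3
  rcases hcases with ⟨⟨s, hs⟩, h1⟩ | ⟨⟨s, hs⟩, h1, h4⟩ | ⟨ht3, h0, h1, h3⟩ | ⟨ht3, h0, h3, hl, hodd⟩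
  · refine closedWeb_isHarmonious_of_even ν hpos h01 (by omega) (by omega) hcard (r := 2 * s)
      (by rw [hs]; ring) h1 (Or.inl ?_)
    have : s ≠ 0 := by
      rintro rfl
      exact (hpos _).ne' hs
    omega
  · exact closedWeb_isHarmonious_of_even ν hpos h01 (by omega) (by omega) hcard (r := s)
      (by rw [hs]; ring) h1 (Or.inr h4)
  · exact key ht3 h0 (Nat.le_of_dvd (hpos _) h1) h3
  · refine key ht3 h0 ?_ h3
    have d2 := h3.trans (hchain 2 ht3 1 (by omega))
    have dl := hchain (t - 1) (by omega) 1 (by omega)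
    -- The second factor is even and divisible by the odd number `n_t > 1`, so it cannot be 2.
    by_contra hlt
    have := h2 ⟨1, ht⟩
    have h12 : ν ⟨1, ht⟩ = 2 := by omega
    rw [h12] at dl
    have := Nat.le_of_dvd (by norm_num) dl
    obtain ⟨j, hj⟩ := hodd
    omega
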